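/- Let $G$ be a compact group with normalized Haar measure $dg$, let $R$ be a continuous unitary representation of $G$ on $V=\mathbb C^{\iota}$ with finite computational basis $|x\rangle$, $x\in\iota$, and write $\bar R$ for the complex conjugate representation. For each class $\lambda$ in the unitary dual $\hat G$ fix a representative $R_\lambda$ on $V_\lambda=\mathbb C^{d_\lambda}$. A Clebsch–Gordan transform (CG) for $R$ consists of multiplicities $m_{\lambda,\nu}$ and tensors $C^{\lambda,\nu,i}:V_\lambda\otimes V\to V_\nu$, $1\le i\le m_{\lambda,\nu}$, which for every $\lambda\in\hat G$ form a unitary intertwiner $R_\lambda\otimes R\simeq\bigoplus_\nu R_\nu\otimes 1_{m_{\lambda,\nu}}$. A dual transform (dCG) of $C$ is a Clebsch–Gordan transform for $\bar R$ with multiplicities $m_{\nu,\lambda}$ and tensors $D^{\lambda,\nu,i}:V_\lambda\otimes\bar V\to V_\nu$, $1\le i\le m_{\nu,\lambda}$, such that $D^{\lambda,\nu,i}_{M',Mx}$ is a positive multiple (depending only on $\lambda,\nu,i$) of $\overline{C^{\nu,\lambda,i}_{M,M'x}}$. The memory is the Hilbert space with orthonormal basis $|\lambda,M,\bar M\rangle$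 ($\lambda\in\hat G$; $M,\bar M\in[d_\lambda]$, with $\bar M$ labelling the basis of $\overline{V_\lambda}$), and $|\varnothing\rangle$ is its basis vector with $\lambda$ trivial. The compressed oracles act on memory $\otimes\,V$ and send $|\lambda,M,\bar M\rangle|x\rangle$ to $|\nu,M',\bar M'\rangle|y\rangle$ with amplitudes $$\begin{aligned}\text{forward } f\mathcal O:&\ \textstyle\sum_i C^{\lambda,\nu,i}_{M',Mx}\,D^{\nu,\lambda,i}_{\bar M,\bar M'y},&\text{conjugate } c\mathcal O:&\ \textstyle\sum_i D^{\lambda,\nu,i}_{M',Mx}\,C^{\nu,\lambda,i}_{\bar M,\bar M'y},\\ \text{transpose } t\mathcal O:&\ \textstyle\sum_i \overline{C^{\lambda,\nu,i}_{\bar M',\bar Mx}}\;\overline{D^{\nu,\lambda,i}_{M,M'y}},&\text{inverse } i\mathcal O:&\ \textstyle\sum_i \overline{D^{\lambda,\nu,i}_{\bar M',\bar Mx}}\;\overline{C^{\nu,\lambda,i}_{M,M'y}},\end{aligned}$$ that is, $f\mathcal O$ is a CG transform on the registers $M,x$ followed by an inverse dCG transform (in its complex conjugate form) on $\bar M$ and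 the output; the others arise by exchanging CG and dCG and/or exchanging the roles of $M$ and $\bar M$. Then a Clebsch–Gordan transform $C$ for $R$ exists; every $C$ has exactly one dual transform $D$; and there are unique unitary operators $f\mathcal O,c\mathcal O,t\mathcal O,i\mathcal O$ with the above matrix elements. Moreover let $n\ge0$, let $q=(q_1,\dots,q_n)$ be any sequence of query types, and let $\mathcal O^{(k)}$ be the oracle of type $q_k$, $\mathcal O^{(k)}_{(y,x)}=(I\otimes\langle y|)\mathcal O^{(k)}(I\otimes|x\rangle)$ and $\mathcal O^{(k)\dagger}_{(x,y)}=(I\otimes\langle x|)\mathcal O^{(k)\dagger}(I\otimes|y\rangle)$. Put $R^{(k)}=R$ if $q_k$ is forward or transpose and $R^{(k)}=\bar R$ otherwise. 1. The compositions $W^\lambda_T:\mathbb{C}^{\iota^n}\to V_\lambda$ of CG and dCG tensors along paths $T=(T_0,t_1,T_1,\dots,t_n,T_n)$ from the trivial irrep to $T_n=\lambda$ (using $C$ at step $k$ if $R^{(k)}=R$ and $D$ if $R^{(k)}=\bar R$) form a unitary intertwiner $\bigotimes_kR^{(k)}\simeq\bigoplus_\lambda R_\lambda\otimes 1_{B(\lambda)}$,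 where $B(\lambda)$ is the (finite) set of these paths; the operators $E^\lambda_{T,S}=(W^\lambda_T)^\dagger W^\lambda_S$ are matrix units spanning the commutant of $\bigotimes_kR^{(k)}$. (For forward queries this is the commutant of $R^{\otimes n}$.) 2. For these $E^\lambda_{T,S}$, and also for the matrix units defined by any other unitary decomposition $\bigotimes_kR^{(k)}\simeq\bigoplus_\lambda R_\lambda\otimes 1_{B(\lambda)}$, and for all $x,y,\hat x,\hat y\in\iota^n$, $$\mathrm{Tr}\Big[\mathcal O^{(n)}_{(y_n,x_n)}\cdots\mathcal O^{(1)}_{(y_1,x_1)}|\varnothing\rangle\langle\varnothing|\mathcal O^{(1)\dagger}_{(\hat x_1,\hat y_1)}\cdots\mathcal O^{(n)\dagger}_{(\hat x_n,\hat y_n)}\Big]=\sum_{\lambda}\frac1{d_\lambda}\sum_{T,S\in B(\lambda)}\langle\hat a|E^\lambda_{T,S}|a\rangle\,\overline{\langle\hat b|E^\lambda_{T,S}|b\rangle},$$ where $(a_k,b_k)=(x_k,y_k)$, $(\hat a_k,\hat b_k)=(\hat x_k,\hat y_k)$ if $q_k$ is forward or conjugate, and $(a_k,b_k)=(y_k,x_k)$,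 $(\hat a_k,\hat b_k)=(\hat y_k,\hat x_k)$ if $q_k$ is transpose or inverse. In particular for $n$ forward queries the right side is $\sum_\lambda\frac1{d_\lambda}\sum_{T,S}\langle\hat x|E^\lambda_{T,S}|x\rangle\overline{\langle\hat y|E^\lambda_{T,S}|y\rangle}$. If all matrix entries of the $E^\lambda_{T,S}$ are real, the complex conjugation may be omitted. 3. The same trace equals the Haar average $$\int_G\prod_{k}Q_k(R(g))_{y_k,x_k}\ \prod_k\big(Q_k(R(g))^\dagger\big)_{\hat x_k,\hat y_k}\,dg,$$ where $Q_k(U)$ is $U$, $\bar U$, $U^{\mathsf T}$ or $U^\dagger$ according to whether $q_k$ is forward, conjugate, transpose or inverse. -/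

import Mathlib

open MeasureTheory
open scoped Matrix Kronecker ComplexConjugate InnerProductSpace

noncomputable section

namespace CompressedOracle

universe u v w

/-! ### Irreducible representations of a topological group -/

/-- The linear representation on `ι → ℂ` given by a group homomorphism into unitary matrices. -/
def toRep {G : Type u} [Group G] {ι : Type v} [Fintype ι] [DecidableEq ι]
    (ρ : G →* Matrix.unitaryGroup ι ℂ) : Representation ℂ G (ι → ℂ) :=
  ((Matrix.toLinAlgEquiv' : Matrix ι ι ℂ ≃ₐ[ℂ] _) : Matrix ι ι ℂ →* ((ι → ℂ) →ₗ[ℂ] (ι → ℂ))).comp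
    ((Matrix.unitaryGroup ι ℂ).subtype.comp ρ)

/-- A continuous irreducible unitary representation, written in an orthonormal basis. -/
structure UnitaryIrrep (G : Type u) [Group G] [TopologicalSpace G] where
  dim : ℕ
  rep : G →* Matrix.unitaryGroup (Fin dim) ℂ
  continuous_rep : Continuous fun g => (rep g : Matrix (Fin dim) (Fin dim) ℂ)
  irreducible : (toRep rep).IsIrreducible

section

variable {G : Type u} [Group G] [TopologicalSpace G]

theorem UnitaryIrrep.dim_pos (p : UnitaryIrrep G) : 0 < p.dim := by
  rcases Nat.eq_zero_or_pos p.dim with h | h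
  · exfalso
    have hi : (toRep p.rep).IsIrreducible := p.irreducible
    obtain ⟨a, b, hab⟩ := hi.toNontrivial
    apply hab
    have : IsEmpty (Fin p.dim) := by rw [h]; infer_instance
    have hs : Subsingleton (Submodule ℂ (Fin p.dim → ℂ)) := inferInstance
    exact Subrepresentation.toSubmodule_injective (Subsingleton.elim _ _)
  · exact h

/-- Unitary equivalence of unitary representations. -/
def UnitaryIrrep.Equivalent (p q : UnitaryIrrep G) : Prop :=
  ∃ U : Matrix (Fin p.dim) (Fin q.dim) ℂ, Uᴴ * U = 1 ∧ U * Uᴴ = 1 ∧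
    ∀ g, U * (q.rep g : Matrix (Fin q.dim) (Fin q.dim) ℂ)
      = (p.rep g : Matrix (Fin p.dim) (Fin p.dim) ℂ) * U

instance irrepSetoid (G : Type u) [Group G] [TopologicalSpace G] : Setoid (UnitaryIrrep G) where
  r := UnitaryIrrep.Equivalent
  iseqv :=
    { refl := fun p => ⟨1, by simp, by simp, by simp⟩
      symm := by
        rintro p q ⟨U, h1, h2, h3⟩
        refine ⟨Uᴴ, by simpa using h2, by simpa using h1, fun g => ?_⟩
        have h := congrArg (fun X : Matrix (Fin p.dim) (Fin q.dim) ℂ => Uᴴ * X * Uᴴ) (h3 g)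
        simp only [Matrix.mul_assoc, h2, Matrix.mul_one] at h
        rw [← Matrix.mul_assoc, h1, Matrix.one_mul] at h
        exact h.symm
      trans := by
        rintro p q r ⟨U, h1, h2, h3⟩ ⟨V, k1, k2, k3⟩
        refine ⟨U * V, ?_, ?_, fun g => ?_⟩
        · rw [Matrix.conjTranspose_mul, Matrix.mul_assoc, ← Matrix.mul_assoc Uᴴ, h1,
            Matrix.one_mul, k1]
        · rw [Matrix.conjTranspose_mul, Matrix.mul_assoc, ← Matrix.mul_assoc V, k2,
            Matrix.one_mul, h2]
        · rw [Matrix.mul_assoc, k3, ← Matrix.mul_assoc, h3, Matrix.mul_assoc] }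

/-- The unitary dual `Ĝ`: equivalence classes of continuous irreducible unitary representations. -/
def UDual (G : Type u) [Group G] [TopologicalSpace G] : Type u := Quotient (irrepSetoid G)

def UDual.mk (p : UnitaryIrrep G) : UDual G := Quotient.mk (irrepSetoid G) p

/-- The trivial representation. -/
def trivialIrrep (G : Type u) [Group G] [TopologicalSpace G] : UnitaryIrrep G where
  dim := 1
  rep := 1
  continuous_rep := continuous_const
  irreducible := by
    have hs : IsSimpleModule ℂ (Fin 1 → ℂ) := isSimpleModule_iff_finrank_eq_one.2 (by simp)
    have ho : IsSimpleOrder (Submodule ℂ (Fin 1 → ℂ)) := (isSimpleModule_iff _ _).1 hs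
    refine { exists_pair_ne := ⟨⊥, ⊤, fun h => ?_⟩, eq_bot_or_eq_top := fun a => ?_ }
    · exact bot_ne_top (α := Submodule ℂ (Fin 1 → ℂ))
        (congrArg Subrepresentation.toSubmodule h)
    · rcases ho.eq_bot_or_eq_top a.toSubmodule with h | h
      · exact Or.inl (Subrepresentation.toSubmodule_injective h)
      · exact Or.inr (Subrepresentation.toSubmodule_injective h)

/-- The label of the trivial representation. -/
def triv (G : Type u) [Group G] [TopologicalSpace G] : UDual G := UDual.mk (trivialIrrep G)

/-- A choice, for every label in `Ĝ`, of a representative together with an orthonormal basis of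
its space. -/
structure IrrepBasis (G : Type u) [Group G] [TopologicalSpace G] where
  irrep : UDual G → UnitaryIrrep G
  mk_irrep : ∀ l, UDual.mk (irrep l) = l

namespace IrrepBasis

/-- The dimension `d_l` of the irrep `l`. -/
def d (σ : IrrepBasis G) (l : UDual G) : ℕ := (σ.irrep l).dim

/-- The matrix of the irrep `l` at a group element. -/
def mat (σ : IrrepBasis G) (l : UDual G) (g : G) : Matrix (Fin (σ.d l)) (Fin (σ.d l)) ℂ :=
  ((σ.irrep l).rep g : Matrix (Fin (σ.irrep l).dim) (Fin (σ.irrep l).dim) ℂ)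

theorem d_pos (σ : IrrepBasis G) (l : UDual G) : 0 < σ.d l := (σ.irrep l).dim_pos

end IrrepBasis

/-! ### Unitary decompositions into irreps -/

/-- `W` is (the family of blocks of) a unitary intertwiner
`ℂ^κ ≃ ⨁_l V_l ⊗ M_l`, `ρ(g) ≃ ⨁_l R_l(g) ⊗ 1`, where `M_l` has an orthonormal basis labelled by the
finite set `B l`; the block `W l T` maps `ℂ^κ` onto `V_l ⊗ |T⟩`. -/
structure IsDecomposition (σ : IrrepBasis G) {κ : Type v} [Fintype κ] [DecidableEq κ]
    (ρ : G → Matrix κ κ ℂ) (B : UDual G → Type w)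
    (W : (l : UDual G) → B l → Matrix (Fin (σ.d l)) κ ℂ) : Prop where
  finite : Finite ((l : UDual G) × B l)
  intertwines : ∀ l T g, W l T * ρ g = σ.mat l g * W l T
  norm_block : ∀ l T, W l T * (W l T)ᴴ = 1
  orth_mult : ∀ l T S, T ≠ S → W l T * (W l S)ᴴ = 0
  orth_irrep : ∀ l l' T S, l ≠ l' → W l T * (W l' S)ᴴ = 0
  complete : ∑ᶠ p : (l : UDual G) × B l, (W p.1 p.2)ᴴ * W p.1 p.2 = 1

/-- The operator `E^l_{T,S} ≃ 1_{V_l} ⊗ |T⟩⟨S|`. -/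
def matUnit {σ : IrrepBasis G} {κ : Type v} {B : UDual G → Type w}
    (W : (l : UDual G) → B l → Matrix (Fin (σ.d l)) κ ℂ) (l : UDual G) (T S : B l) :
    Matrix κ κ ℂ := (W l T)ᴴ * W l S

/-- `E` is a system of (nonzero) matrix units of the commutant of `ρ`. -/
structure IsCommutantMatrixUnits {κ : Type v} [Fintype κ] (ρ : G → Matrix κ κ ℂ)
    (B : UDual G → Type w) (E : (l : UDual G) → B l → B l → Matrix κ κ ℂ) : Prop where
  ne_zero : ∀ l T S, E l T S ≠ 0
  star : ∀ l T S, (E l T S)ᴴ = E l S T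
  mul_same : ∀ l T S U, E l T S * E l S U = E l T U
  mul_ne : ∀ l T S S' U, S ≠ S' → E l T S * E l S' U = 0
  mul_irrep : ∀ l l' T S T' S', l ≠ l' → E l T S * E l' T' S' = 0
  span : (Submodule.span ℂ {X | ∃ l T S, X = E l T S} : Set (Matrix κ κ ℂ))
    = {X | ∀ g, X * ρ g = ρ g * X}

/-! ### Clebsch–Gordan transforms -/

variable {ι : Type v} [Fintype ι] [DecidableEq ι]

/-- The complex conjugate representation, as a matrix-valued function. -/
def conjRep (R : G →* Matrix.unitaryGroup ι ℂ) (g : G) : Matrix ι ι ℂ :=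
  ((R g : Matrix ι ι ℂ)).map star

/-- Families of Clebsch–Gordan tensors: for irreps `l`, `l'` and a multiplicity label `i` (there are
`m l l'` of them), the matrix of a map `V_l ⊗ V → V_{l'}`. -/
abbrev CGTensor (σ : IrrepBasis G) (ι : Type v) (m : UDual G → UDual G → ℕ) :=
  (l l' : UDual G) → Fin (m l l') → Matrix (Fin (σ.d l')) (Fin (σ.d l) × ι) ℂ

/-- `C` is a Clebsch–Gordan transform for tensoring with `ρ`: for every irrep `l` it is a unitary
intertwiner `R_l ⊗ ρ ≃ ⨁_{l'} R_{l'} ⊗ 1_{m l l'}`. -/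
def IsCG (σ : IrrepBasis G) (ρ : G → Matrix ι ι ℂ) (m : UDual G → UDual G → ℕ)
    (C : CGTensor σ ι m) : Prop :=
  ∀ l, IsDecomposition σ (fun g => σ.mat l g ⊗ₖ ρ g) (fun l' => Fin (m l l')) (C l)

/-- `D` is the dual Clebsch–Gordan transform belonging to `C`: a Clebsch–Gordan transform for
tensoring with the conjugate of `R`, whose multiplicity basis and phases are matched with those of
`C`, i.e. each tensor `D l l' i : V_l ⊗ V̄ → V_{l'}` is a positive multiple of the tensor
obtained from `C l' l i : V_{l'} ⊗ V → V_l` by taking the adjoint and bending the wire `V`. -/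
structure IsDualCG (σ : IrrepBasis G) (R : G →* Matrix.unitaryGroup ι ℂ)
    {m : UDual G → UDual G → ℕ} (C : CGTensor σ ι m)
    (D : CGTensor σ ι fun l l' => m l' l) : Prop where
  isCG : IsCG σ (conjRep R) (fun l l' => m l' l) D
  matched : ∀ l l' (i : Fin (m l' l)), ∃ c : ℝ, 0 < c ∧
    ∀ M' M x, D l l' i M' (M, x) = (c : ℂ) * conj (C l' l i M (M', x))

/-! ### The four query types -/

inductive Query
  | forward
  | conjugate
  | transpose
  | inverse

/-- The operator applied by a query to `A`: `A`, `Ā`, `Aᵀ`, or `A†` (for unitary `A`, `A⁻¹`). -/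
def Query.op : Query → Matrix ι ι ℂ → Matrix ι ι ℂ
  | .forward, A => A
  | .conjugate, A => A.map star
  | .transpose, A => Aᵀ
  | .inverse, A => Aᴴ

/-- Among `R` and its conjugate, the representation whose matrix elements the query reads:
`R` for forward and transpose queries, `R̄` for conjugate and inverse ones. -/
def Query.base (R : G →* Matrix.unitaryGroup ι ℂ) : Query → G → Matrix ι ι ℂ
  | .forward, g => R g
  | .conjugate, g => conjRep R g
  | .transpose, g => R g
  | .inverse, g => conjRep R g

/-- The column index of `Query.base` which is read when the query has input `x`, output `y`. -/
def Query.col : Query → ι → ι → ι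
  | .forward, x, _ => x
  | .conjugate, x, _ => x
  | .transpose, _, y => y
  | .inverse, _, y => y

/-- The row index of `Query.base` which is read when the query has input `x`, output `y`. -/
def Query.row : Query → ι → ι → ι
  | .forward, _, y => y
  | .conjugate, _, y => y
  | .transpose, x, _ => x
  | .inverse, x, _ => x

/-- The representation `g ↦ ⨂_k R^{(k)}(g)`, with `R^{(k)}` equal to `R` or `R̄` according to
the `k`-th query; it is `R^{⊗n}` when all queries are forward. -/
def tensorRep (R : G →* Matrix.unitaryGroup ι ℂ) {n : ℕ} (q : Fin n → Query) (g : G) :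
    Matrix (Fin n → ι) (Fin n → ι) ℂ :=
  Matrix.of fun a b => ∏ k, (q k).base R g (a k) (b k)

/-! ### Paths of irreps -/

/-- Number of multiplicity labels for a step from `l` to `l'`. -/
def stepMult (m : UDual G → UDual G → ℕ) : Query → UDual G → UDual G → ℕ
  | .forward, l, l' => m l l'
  | .conjugate, l, l' => m l' l
  | .transpose, l, l' => m l l'
  | .inverse, l, l' => m l' l

/-- The tensor `V_l ⊗ V → V_{l'}` or `V_l ⊗ V̄ → V_{l'}` of a step from `l` to `l'`. -/
def stepTensor {σ : IrrepBasis G} {m : UDual G → UDual G → ℕ} (C : CGTensor σ ι m)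
    (D : CGTensor σ ι fun l l' => m l' l) :
    (q : Query) → CGTensor σ ι (stepMult m q)
  | .forward => C
  | .conjugate => D
  | .transpose => C
  | .inverse => D

/-- `B(l)`: paths `(T_0, t_1, T_1, …, t_n, T_n)` of irreps with multiplicity labels, starting at the
trivial irrep `T_0` and ending at `T_n = l`. -/
def IrrepPath (m : UDual G → UDual G → ℕ) : (n : ℕ) → (Fin n → Query) → UDual G → Type u
  | 0, _, l => ULift (PLift (l = triv G))
  | n + 1, q, l' =>
      (l : UDual G) × (IrrepPath m n (Fin.init q) l × Fin (stepMult m (q (Fin.last n)) l l'))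

/-- The concatenation of the Clebsch–Gordan tensors along a path, a map
`⨂_k V^{(k)} → V_l`. -/
def pathTensor {σ : IrrepBasis G} {m : UDual G → UDual G → ℕ} (C : CGTensor σ ι m)
    (D : CGTensor σ ι fun l l' => m l' l) :
    (n : ℕ) → (q : Fin n → Query) → (l : UDual G) → IrrepPath m n q l →
      Matrix (Fin (σ.d l)) (Fin n → ι) ℂ
  | 0, _, _, _ => Matrix.of fun _ _ => 1
  | n + 1, q, l', T => Matrix.of fun M' x =>
      ∑ M : Fin (σ.d T.1), stepTensor C D (q (Fin.last n)) T.1 l' T.2.2 M' (M, x (Fin.last n)) *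
        pathTensor C D n (Fin.init q) T.1 T.2.1 M (Fin.init x)

/-! ### The compressed oracles -/

/-- Basis states `|l, M, M̄⟩` of the memory `⨁_l V_l ⊗ V̄_l`: an irrep label `l`, a basis label of
`V_l` and a basis label of its conjugate. -/
abbrev MemIdx (σ : IrrepBasis G) := (l : UDual G) × (Fin (σ.d l) × Fin (σ.d l))

/-- The memory Hilbert space. -/
abbrev Mem (σ : IrrepBasis G) := lp (fun _ : MemIdx σ => ℂ) 2

/-- The Hilbert space (working register) ⊗ (memory), as the direct sum of copies of the memory over
the basis states of the working register. -/
abbrev Joint (σ : IrrepBasis G) (ι : Type v) [Fintype ι] := PiLp 2 fun _ : ι => Mem σ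

/-- The basis vector `|l, M, M̄⟩` of the memory. -/
def ket {σ : IrrepBasis G} (a : MemIdx σ) : Mem σ :=
  letI := Classical.decEq (MemIdx σ)
  lp.single 2 a 1

/-- The initial memory state `|∅⟩`: the basis vector of the trivial irrep. -/
def vacuum (σ : IrrepBasis G) : Mem σ :=
  ket ⟨triv G, ⟨0, σ.d_pos _⟩, ⟨0, σ.d_pos _⟩⟩

/-- Matrix element of the compressed oracles from `|l, M, M̄⟩|x⟩` to `|l', M', M̄'⟩|y⟩`.

* forward: the transform `C` acts on the registers `M, x`, and produces `l'`, a multiplicity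
  label `i` and `M'`; then the inverse of the dual transform (in its conjugate form, decomposing
  `V̄_{l'} ⊗ V` into the spaces `V̄_l`) turns `l`, `i`, `M̄` into `M̄'` and the output `y`;
* conjugate: the same circuit with `C` and `D` exchanged;
* transpose, inverse: the two previous circuits with the roles of `V_l` and `V̄_l` exchanged, so
  that the first gate acts on `M̄, x` and the second one on `M`. -/
def kernel {σ : IrrepBasis G} {m : UDual G → UDual G → ℕ} (C : CGTensor σ ι m)
    (D : CGTensor σ ι fun l l' => m l' l) :
    Query → MemIdx σ → ι → MemIdx σ → ι → ℂ
  | .forward, ⟨l, M, N⟩, x, ⟨l', M', N'⟩, y =>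
      ∑ i : Fin (m l l'), C l l' i M' (M, x) * D l' l i N (N', y)
  | .conjugate, ⟨l, M, N⟩, x, ⟨l', M', N'⟩, y =>
      ∑ i : Fin (m l' l), D l l' i M' (M, x) * C l' l i N (N', y)
  | .transpose, ⟨l, M, N⟩, x, ⟨l', M', N'⟩, y =>
      ∑ i : Fin (m l l'), conj (C l l' i N' (N, x)) * conj (D l' l i M (M', y))
  | .inverse, ⟨l, M, N⟩, x, ⟨l', M', N'⟩, y =>
      ∑ i : Fin (m l' l), conj (D l l' i N' (N, x)) * conj (C l' l i M (M', y))

/-- `⟨y| ⊗ 1`, from working register ⊗ memory to the memory. -/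
def bra (σ : IrrepBasis G) (y : ι) : Joint σ ι →L[ℂ] Mem σ :=
  PiLp.proj 2 (fun _ : ι => Mem σ) y

/-- The operator `X_{(y, x)} = (1 ⊗ ⟨y|) X (1 ⊗ |x⟩)` on the memory. -/
def block {σ : IrrepBasis G} (X : Joint σ ι →L[ℂ] Joint σ ι) (y x : ι) : Mem σ →L[ℂ] Mem σ :=
  bra σ y ∘L X ∘L ContinuousLinearMap.adjoint (bra σ x)

/-- The unitary operator `O` is the compressed oracle of type `q` built from `C` and `D`. -/
def IsOracle {σ : IrrepBasis G} {m : UDual G → UDual G → ℕ} (C : CGTensor σ ι m)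
    (D : CGTensor σ ι fun l l' => m l' l) (q : Query)
    (O : unitary (Joint σ ι →L[ℂ] Joint σ ι)) : Prop :=
  ∀ (a : MemIdx σ) (x : ι) (b : MemIdx σ) (y : ι),
    ⟪ket b, block (O : Joint σ ι →L[ℂ] Joint σ ι) y x (ket a)⟫_ℂ = kernel C D q a x b y

/-- The operator
`O_{(y_n,x_n)} ⋯ O_{(y_1,x_1)} |∅⟩⟨∅| O†_{(x̂_1,ŷ_1)} ⋯ O†_{(x̂_n,ŷ_n)}` on the memory, where the
`k`-th oracle used has type `q k`. -/
def memoryOp {σ : IrrepBasis G} (O : Query → unitary (Joint σ ι →L[ℂ] Joint σ ι)) {n : ℕ}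
    (q : Fin n → Query) (x y x' y' : Fin n → ι) : Mem σ →L[ℂ] Mem σ :=
  (List.ofFn fun k => block (O (q k) : Joint σ ι →L[ℂ] Joint σ ι) (y k) (x k)).reverse.prod *
    InnerProductSpace.rankOne ℂ (vacuum σ) (vacuum σ) *
    (List.ofFn fun k =>
      block (star (O (q k)) : Joint σ ι →L[ℂ] Joint σ ι) (x' k) (y' k)).prod

/-- `t` is the trace of `X`: the sum of the diagonal matrix elements. -/
def HasTrace {σ : IrrepBasis G} (X : Mem σ →L[ℂ] Mem σ) (t : ℂ) : Prop :=
  HasSum (fun a : MemIdx σ => ⟪ket a, X (ket a)⟫_ℂ) t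

end

end CompressedOracle

end

open CompressedOracle

/-! Schur's lemma makes the matched dual transform explicit. The tensor `D l l' i` has to be `√(d_l'
/ d_l)` times the adjoint of `C l' l i` with the wire `V` bent (`IsDualCG.eq_dualTensor`), and these
bent tensors do form a Clebsch–Gordan transform for `R̄` (`IsUnitaryRep.isCG_dualTensor`). With this
substituted, every oracle takes one form: from `l` to `l'` its amplitude is `√(d_l / d_l')` times a
sum over `i` of a step tensor acting on `M` and the complex conjugate of the same tensor acting on
`M̄` (`kernel_eq`). The query type only decides whether that tensor is `C` or `D`, and which of
input and output is paired with `M`. The square roots telescope, so after `n` queries the amplitude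
at `|l, M, M̄⟩` is `d_l^(-1/2) ∑_T W_T(M, a) conj (W_T(M̄, b))`, summed over paths
(`memState_apply`). The trace is an inner product of two such states, which is the formula in the
matrix units of the path basis.

On the group side, any decomposition gives `ρ(g) = ∑ Wᴴ R_l(g) W`, and Schur orthogonality evaluates
the average of `ρ(g)_{ba} conj (ρ(g)_{b'a'})` to the same expression in the matrix units
(`IsDecomposition.integral_eq`). The Haar integral does not see the decomposition, so it carries the
trace formula from the path basis to every other basis.

Decompositions exist because a maximal orthonormal family of intertwiners is complete. The oracles
are unitary because a Clebsch–Gordan transform followed by an inverse one has finitely supported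
orthonormal columns, and exchanging `M`, `M̄` and `C`, `D` turns columns into rows. -/

noncomputable section

namespace CompressedOracle

universe u v w

/-! ### Unitary representations in matrix form and Schur's lemma -/

section Representations

variable {G : Type u} [Group G] [TopologicalSpace G] {κ : Type v} [Fintype κ] [DecidableEq κ]

/-- A continuous unitary representation, as a matrix-valued function. -/
structure IsUnitaryRep (ρ : G → Matrix κ κ ℂ) : Prop where
  continuous : Continuous ρ
  map_one : ρ 1 = 1
  map_mul : ∀ g h, ρ (g * h) = ρ g * ρ h
  map_inv : ∀ g, ρ g⁻¹ = (ρ g)ᴴ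

theorem IsUnitaryRep.of_hom (R : G →* Matrix.unitaryGroup κ ℂ)
    (hR : Continuous fun g => (R g : Matrix κ κ ℂ)) :
    IsUnitaryRep fun g => (R g : Matrix κ κ ℂ) where
  continuous := hR
  map_one := by simp
  map_mul g h := by simp
  map_inv g := by rw [_root_.map_inv]; rfl

theorem IsUnitaryRep.mul_conjTranspose {ρ : G → Matrix κ κ ℂ} (hρ : IsUnitaryRep ρ) (g : G) :
    ρ g * (ρ g)ᴴ = 1 := by
  rw [← hρ.map_inv, ← hρ.map_mul, mul_inv_cancel, hρ.map_one]

theorem IsUnitaryRep.conjTranspose_mul {ρ : G → Matrix κ κ ℂ} (hρ : IsUnitaryRep ρ) (g : G) :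
    (ρ g)ᴴ * ρ g = 1 := by
  rw [← hρ.map_inv, ← hρ.map_mul, inv_mul_cancel, hρ.map_one]

/-- Unitarity turns the adjoint of the relation at `g⁻¹` into the relation for `Aᴴ` at `g`. -/
theorem IsUnitaryRep.intertwines_conjTranspose {κ' : Type*} [Fintype κ'] [DecidableEq κ']
    {ρ : G → Matrix κ κ ℂ} {τ : G → Matrix κ' κ' ℂ} (hρ : IsUnitaryRep ρ) (hτ : IsUnitaryRep τ)
    {A : Matrix κ' κ ℂ} (hA : ∀ g, A * ρ g = τ g * A) (g : G) : Aᴴ * τ g = ρ g * Aᴴ := by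
  have h := congrArg Matrix.conjTranspose (hA g⁻¹)
  rw [Matrix.conjTranspose_mul, Matrix.conjTranspose_mul, hρ.map_inv, hτ.map_inv,
    Matrix.conjTranspose_conjTranspose, Matrix.conjTranspose_conjTranspose] at h
  exact h.symm

theorem toRep_apply {G : Type u} [Group G] (ρ : G →* Matrix.unitaryGroup κ ℂ) (g : G) (v : κ → ℂ) :
    toRep ρ g v = (ρ g : Matrix κ κ ℂ) *ᵥ v := by
  simp [toRep]

theorem UnitaryIrrep.eq_bot_or_eq_top (p : UnitaryIrrep G) (S : Submodule ℂ (Fin p.dim → ℂ))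
    (hS : ∀ g, ∀ v ∈ S, (p.rep g : Matrix _ _ ℂ) *ᵥ v ∈ S) : S = ⊥ ∨ S = ⊤ := by
  have hi : (toRep p.rep).IsIrreducible := p.irreducible
  let S' : Subrepresentation (toRep p.rep) :=
    ⟨S, fun g v hv => by rw [toRep_apply]; exact hS g v hv⟩
  rcases hi.eq_bot_or_eq_top S' with h | h
  · exact Or.inl (congrArg Subrepresentation.toSubmodule h)
  · exact Or.inr (congrArg Subrepresentation.toSubmodule h)

theorem IrrepBasis.isUnitaryRep (σ : IrrepBasis G) (l : UDual G) : IsUnitaryRep (σ.mat l) :=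
  IsUnitaryRep.of_hom (σ.irrep l).rep (σ.irrep l).continuous_rep

theorem IrrepBasis.eq_bot_or_eq_top (σ : IrrepBasis G) (l : UDual G)
    (S : Submodule ℂ (Fin (σ.d l) → ℂ)) (hS : ∀ g, ∀ v ∈ S, σ.mat l g *ᵥ v ∈ S) :
    S = ⊥ ∨ S = ⊤ :=
  (σ.irrep l).eq_bot_or_eq_top S hS

theorem IrrepBasis.eq_of_equiv (σ : IrrepBasis G) {l l' : UDual G}
    (U : Matrix (Fin (σ.d l)) (Fin (σ.d l')) ℂ) (h1 : Uᴴ * U = 1) (h2 : U * Uᴴ = 1)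
    (h3 : ∀ g, U * σ.mat l' g = σ.mat l g * U) : l = l' := by
  rw [← σ.mk_irrep l, ← σ.mk_irrep l']
  exact Quotient.sound ⟨U, h1, h2, h3⟩

theorem IrrepBasis.exists_equiv (σ : IrrepBasis G) {d : ℕ}
    (rep : G →* Matrix.unitaryGroup (Fin d) ℂ)
    (hc : Continuous fun g => (rep g : Matrix (Fin d) (Fin d) ℂ))
    (hirr : (toRep rep).IsIrreducible) :
    ∃ (l : UDual G) (U : Matrix (Fin (σ.d l)) (Fin d) ℂ), U * Uᴴ = 1 ∧
      ∀ g, U * (rep g : Matrix (Fin d) (Fin d) ℂ) = σ.mat l g * U := by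
  obtain ⟨U, -, hU2, hU3⟩ : (σ.irrep (UDual.mk ⟨d, rep, hc, hirr⟩)).Equivalent ⟨d, rep, hc, hirr⟩ :=
    Quotient.exact (σ.mk_irrep (UDual.mk ⟨d, rep, hc, hirr⟩))
  exact ⟨_, U, hU2, hU3⟩

/-- Schur's lemma for endomorphisms. -/
theorem IrrepBasis.schur_scalar (σ : IrrepBasis G) (l : UDual G)
    (A : Matrix (Fin (σ.d l)) (Fin (σ.d l)) ℂ) (hA : ∀ g, A * σ.mat l g = σ.mat l g * A) :
    ∃ c : ℂ, A = c • 1 := by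
  have : Nonempty (Fin (σ.d l)) := ⟨⟨0, σ.d_pos l⟩⟩
  -- Over `ℂ` there is an eigenvalue; its eigenspace is invariant because `A` commutes with the
  -- irrep, so it is the whole space.
  obtain ⟨c, hc⟩ := Module.End.exists_eigenvalue (Matrix.toLin' A)
  refine ⟨c, ?_⟩
  obtain ⟨v, hv⟩ := hc.exists_hasEigenvector
  rcases σ.eq_bot_or_eq_top l (Module.End.eigenspace (Matrix.toLin' A) c)
    (fun g w hw => by
      rw [Module.End.mem_eigenspace_iff, Matrix.toLin'_apply] at hw ⊢
      rw [Matrix.mulVec_mulVec, hA g, ← Matrix.mulVec_mulVec, hw, Matrix.mulVec_smul]) with h | h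
  · exact absurd h hc
  · apply Matrix.toLin'.injective
    ext1 j
    apply LinearMap.ext
    intro z
    have hz : (Pi.single j z : Fin (σ.d l) → ℂ) ∈
        Module.End.eigenspace (Matrix.toLin' A) c := by
      rw [h]; trivial
    rw [Module.End.mem_eigenspace_iff] at hz
    simpa using hz

theorem IrrepBasis.intertwines_conjTranspose (σ : IrrepBasis G) {l l' : UDual G}
    {A : Matrix (Fin (σ.d l)) (Fin (σ.d l')) ℂ}
    (hA : ∀ g, A * σ.mat l' g = σ.mat l g * A) (g : G) : Aᴴ * σ.mat l g = σ.mat l' g * Aᴴ :=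
  (σ.isUnitaryRep l').intertwines_conjTranspose (σ.isUnitaryRep l) hA g

/-- Schur's lemma for inequivalent irreps. -/
theorem IrrepBasis.schur_zero (σ : IrrepBasis G) {l l' : UDual G} (hl : l ≠ l')
    (A : Matrix (Fin (σ.d l)) (Fin (σ.d l')) ℂ)
    (hA : ∀ g, A * σ.mat l' g = σ.mat l g * A) : A = 0 := by
  by_contra hne
  have hA' := σ.intertwines_conjTranspose hA
  -- Both `Aᴴ * A` and `A * Aᴴ` are scalar. The scalars agree and equal the squared norm of a
  -- nonzero column, so a real multiple of `A` is a unitary equivalence, which forces `l = l'`.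
  obtain ⟨c, hc⟩ := σ.schur_scalar l' (Aᴴ * A) fun g => by
    rw [Matrix.mul_assoc, hA, ← Matrix.mul_assoc, hA', Matrix.mul_assoc]
  obtain ⟨c', hc'⟩ := σ.schur_scalar l (A * Aᴴ) fun g => by
    rw [Matrix.mul_assoc, hA', ← Matrix.mul_assoc, hA, Matrix.mul_assoc]
  obtain ⟨i, j, hij⟩ : ∃ i j, A i j ≠ 0 := by
    by_contra h
    push Not at h
    exact hne (by ext i j; exact h i j)
  have hcc : c' = c := by
    have h1 : c' • A = c • A := by
      have : (A * Aᴴ) * A = A * (Aᴴ * A) := Matrix.mul_assoc _ _ _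
      rwa [hc, hc', Matrix.smul_mul, Matrix.one_mul, Matrix.mul_smul, Matrix.mul_one] at this
    have h2 := congrFun (congrFun h1 i) j
    simp only [Matrix.smul_apply, smul_eq_mul] at h2
    exact mul_right_cancel₀ hij h2
  have hcr : c = ((∑ k, ‖A k j‖ ^ 2 : ℝ) : ℂ) := by
    have := congrFun (congrFun hc j) j
    simp only [Matrix.mul_apply, Matrix.conjTranspose_apply, Matrix.smul_apply, Matrix.one_apply_eq,
      smul_eq_mul, mul_one] at this
    rw [← this]
    push_cast
    exact Finset.sum_congr rfl fun k _ => Complex.conj_mul' _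
  have hpos : 0 < ∑ k, ‖A k j‖ ^ 2 :=
    lt_of_lt_of_le (by positivity)
      (Finset.single_le_sum (f := fun k => ‖A k j‖ ^ 2) (fun k _ => by positivity)
        (Finset.mem_univ i))
  set r := ∑ k, ‖A k j‖ ^ 2
  have hs : ((Real.sqrt r : ℂ))⁻¹ * (Real.sqrt r : ℂ)⁻¹ * (r : ℂ) = 1 := by
    have h0 : (Real.sqrt r : ℂ) ≠ 0 := by
      exact_mod_cast (Real.sqrt_pos.2 hpos).ne'
    have h1 : (r : ℂ) = (Real.sqrt r : ℂ) * Real.sqrt r := by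
      rw [← Complex.ofReal_mul, Real.mul_self_sqrt hpos.le]
    rw [h1]; field_simp
  refine hl (σ.eq_of_equiv (((Real.sqrt r : ℂ)⁻¹) • A) ?_ ?_ fun g => ?_)
  · rw [Matrix.conjTranspose_smul, Matrix.smul_mul, Matrix.mul_smul, hc, hcr, smul_smul, smul_smul]
    simp only [star_inv₀, RCLike.star_def, Complex.conj_ofReal]
    rw [hs, one_smul]
  · rw [Matrix.conjTranspose_smul, Matrix.smul_mul, Matrix.mul_smul, hc', hcc, hcr, smul_smul, smul_smul]
    simp only [star_inv₀, RCLike.star_def, Complex.conj_ofReal]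
    rw [hs, one_smul]
  · rw [Matrix.smul_mul, Matrix.mul_smul]
    exact congrArg _ (hA g)

/-- A nonzero invariant subspace contains an irreducible one. -/
theorem IsUnitaryRep.exists_irrep (σ : IrrepBasis G) {ρ : G → Matrix κ κ ℂ} (hρ : IsUnitaryRep ρ)
    (S : Submodule ℂ (κ → ℂ)) (hS : ∀ g, ∀ v ∈ S, ρ g *ᵥ v ∈ S) (hne : S ≠ ⊥) :
    ∃ (l : UDual G) (A : Matrix (Fin (σ.d l)) κ ℂ), A * Aᴴ = 1 ∧
      (∀ g, A * ρ g = σ.mat l g * A) ∧ ∀ v, Aᴴ *ᵥ v ∈ S := by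
  -- A minimal nonzero invariant subspace of `S`. The columns of `B` below are an orthonormal basis
  -- of it, and the irrep is the compression `Bᴴ * ρ g * B`.
  obtain ⟨S₀, ⟨hS₀, hne₀, hle₀⟩, hmin⟩ := (wellFounded_lt (α := Submodule ℂ (κ → ℂ))).has_min
    {S' | (∀ g, ∀ v ∈ S', ρ g *ᵥ v ∈ S') ∧ S' ≠ ⊥ ∧ S' ≤ S} ⟨S, hS, hne, le_rfl⟩
  let e := (WithLp.linearEquiv 2 ℂ (κ → ℂ)).symm
  let S₁ : Submodule ℂ (EuclideanSpace ℂ κ) := S₀.map (e : (κ → ℂ) →ₗ[ℂ] EuclideanSpace ℂ κ)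
  let b := stdOrthonormalBasis ℂ S₁
  let d := Module.finrank ℂ S₁
  let B : Matrix κ (Fin d) ℂ := Matrix.of fun k i => (b i : EuclideanSpace ℂ κ) k
  have hBB : Bᴴ * B = 1 := by
    ext i j
    have := orthonormal_iff_ite.1 b.orthonormal i j
    rw [Submodule.coe_inner, PiLp.inner_apply] at this
    rw [Matrix.mul_apply, Matrix.one_apply, ← this]
    refine Finset.sum_congr rfl fun k _ => ?_
    simp [B, Matrix.conjTranspose_apply, mul_comm]
  have hmem : ∀ v, B *ᵥ v ∈ S₀ := fun v => by
    have h1 : ((∑ i, v i • b i : S₁) : EuclideanSpace ℂ κ) ∈ S₁ := Subtype.property _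
    obtain ⟨w, hw, hw'⟩ := h1
    have : w = B *ᵥ v := by
      ext k
      have h2 := congrArg (fun z : EuclideanSpace ℂ κ => z k) hw'
      simp only [Submodule.coe_sum, Submodule.coe_smul, WithLp.ofLp_sum, WithLp.ofLp_smul,
        Finset.sum_apply, Pi.smul_apply, smul_eq_mul] at h2
      simp only [Matrix.mulVec, dotProduct, B, Matrix.of_apply]
      refine Eq.trans (show w k = _ from h2) (Finset.sum_congr rfl fun i _ => mul_comm _ _)
    rwa [← this]
  have hfix : ∀ w ∈ S₀, B *ᵥ (Bᴴ *ᵥ w) = w := fun w hw => by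
    obtain ⟨v, rfl⟩ : ∃ v, w = B *ᵥ v := by
      let w' : S₁ := ⟨e w, w, hw, rfl⟩
      refine ⟨b.repr w', ?_⟩
      have h := congrArg (Subtype.val) (b.sum_repr w')
      ext k
      have h2 := congrArg (fun z : EuclideanSpace ℂ κ => z k) h
      simp only [Submodule.coe_sum, Submodule.coe_smul, WithLp.ofLp_sum, WithLp.ofLp_smul,
        Finset.sum_apply, Pi.smul_apply, smul_eq_mul] at h2
      simp only [Matrix.mulVec, dotProduct, B, Matrix.of_apply]
      refine Eq.trans (show w k = _ from h2.symm) (Finset.sum_congr rfl fun i _ => mul_comm _ _)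
    rw [Matrix.mulVec_mulVec v Bᴴ, hBB, Matrix.one_mulVec]
  have hint : ∀ g, ρ g * B = B * (Bᴴ * ρ g * B) := fun g => by
    apply Matrix.ext_of_mulVec_single
    intro i
    rw [← Matrix.mulVec_mulVec, ← Matrix.mulVec_mulVec, ← Matrix.mulVec_mulVec,
      ← Matrix.mulVec_mulVec, hfix _ (hS₀ g _ (hmem _))]
  have hone : Bᴴ * ρ 1 * B = 1 := by rw [hρ.map_one, Matrix.mul_one, hBB]
  have hmul : ∀ g h, Bᴴ * ρ (g * h) * B = (Bᴴ * ρ g * B) * (Bᴴ * ρ h * B) := fun g h => by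
    rw [hρ.map_mul, Matrix.mul_assoc Bᴴ, Matrix.mul_assoc (ρ g), hint h, Matrix.mul_assoc Bᴴ (ρ g) B,
      Matrix.mul_assoc Bᴴ (ρ g * B), Matrix.mul_assoc (ρ g) B]
  have hinv : ∀ g, Bᴴ * ρ g⁻¹ * B = (Bᴴ * ρ g * B)ᴴ := fun g => by
    rw [hρ.map_inv, Matrix.conjTranspose_mul, Matrix.conjTranspose_mul,
      Matrix.conjTranspose_conjTranspose, Matrix.mul_assoc]
  let rep : G →* Matrix.unitaryGroup (Fin d) ℂ :=
    { toFun := fun g => ⟨Bᴴ * ρ g * B, by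
        rw [Matrix.mem_unitaryGroup_iff, Matrix.star_eq_conjTranspose, ← hinv, ← hmul,
          mul_inv_cancel, hone]⟩
      map_one' := Subtype.ext hone
      map_mul' := fun g h => Subtype.ext (hmul g h) }
  have hirr : (toRep rep).IsIrreducible := by
    refine { exists_pair_ne := ⟨⊥, ⊤, fun h => ?_⟩, eq_bot_or_eq_top := fun a => ?_ }
    · have h : (⊥ : Submodule ℂ (Fin d → ℂ)) = ⊤ := congrArg Subrepresentation.toSubmodule h
      apply hne₀
      rw [Submodule.eq_bot_iff]
      intro w hw
      have : Bᴴ *ᵥ w ∈ (⊥ : Submodule ℂ (Fin d → ℂ)) := by rw [h]; trivial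
      rw [← hfix w hw, (Submodule.mem_bot ℂ).1 this, Matrix.mulVec_zero]
    -- `B` carries an invariant subspace of the compression to an invariant subspace of `S₀`, so
    -- minimality leaves only the two extremes.
    · have hmap : a.toSubmodule.map B.mulVecLin = ⊥ ∨ a.toSubmodule.map B.mulVecLin = S₀ := by
        by_contra hcon
        push Not at hcon
        have hle : a.toSubmodule.map B.mulVecLin ≤ S₀ := by
          rintro _ ⟨v, _, rfl⟩
          exact hmem v
        refine hmin (a.toSubmodule.map B.mulVecLin) ⟨?_, hcon.1, hle.trans hle₀⟩
          (lt_of_le_of_ne hle hcon.2)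
        rintro g _ ⟨v, hv, rfl⟩
        refine ⟨_, a.apply_mem_toSubmodule g hv, ?_⟩
        rw [toRep_apply]
        change B *ᵥ ((Bᴴ * ρ g * B) *ᵥ v) = ρ g *ᵥ (B *ᵥ v)
        rw [Matrix.mulVec_mulVec, ← hint, Matrix.mulVec_mulVec]
      rcases hmap with h | h
      · refine Or.inl (Subrepresentation.toSubmodule_injective ?_)
        refine (Submodule.eq_bot_iff _).2 fun v hv => ?_
        have : B *ᵥ v ∈ a.toSubmodule.map B.mulVecLin := ⟨v, hv, rfl⟩
        rw [h, Submodule.mem_bot] at this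
        have h2 := congrArg (fun z => Bᴴ *ᵥ z) this
        simpa [Matrix.mulVec_mulVec, hBB] using h2
      · refine Or.inr (Subrepresentation.toSubmodule_injective ?_)
        refine (Submodule.eq_top_iff').2 fun v => ?_
        have : B *ᵥ v ∈ a.toSubmodule.map B.mulVecLin := by rw [h]; exact hmem v
        obtain ⟨v', hv', h'⟩ := this
        have h2 : Bᴴ *ᵥ (B *ᵥ v') = Bᴴ *ᵥ (B *ᵥ v) := congrArg (fun z => Bᴴ *ᵥ z) h'
        rw [Matrix.mulVec_mulVec, Matrix.mulVec_mulVec, hBB, Matrix.one_mulVec,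
          Matrix.one_mulVec] at h2
        rw [← h2]; exact hv'
  obtain ⟨l, U, hU2, hU3⟩ := σ.exists_equiv rep
    ((continuous_const.matrix_mul hρ.continuous).matrix_mul continuous_const) hirr
  refine ⟨l, U * Bᴴ, ?_, fun g => ?_, fun v => hle₀ ?_⟩
  · rw [Matrix.conjTranspose_mul, Matrix.conjTranspose_conjTranspose, Matrix.mul_assoc,
      ← Matrix.mul_assoc Bᴴ, hBB, Matrix.one_mul, hU2]
  -- The adjoint of `hint` at `g⁻¹`: by unitarity the orthogonal complement of `S₀` is invariant
  -- too.
  · have h1 : Bᴴ * ρ g = (Bᴴ * ρ g * B) * Bᴴ := by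
      have := congrArg Matrix.conjTranspose (hint g⁻¹)
      rw [hinv] at this
      simpa [Matrix.conjTranspose_mul, hρ.map_inv, Matrix.mul_assoc] using this
    have h2 : U * (Bᴴ * ρ g * B) = σ.mat l g * U := hU3 g
    rw [Matrix.mul_assoc, h1, ← Matrix.mul_assoc U, h2, Matrix.mul_assoc]
  · rw [Matrix.conjTranspose_mul, Matrix.conjTranspose_conjTranspose, ← Matrix.mulVec_mulVec]
    exact hmem _

end Representations

/-! ### Reduction of sums over the unitary dual to finite sums -/

theorem exists_finset_isEmpty {α : Type*} {B : α → Type*} (h : Finite ((l : α) × B l)) :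
    ∃ L : Finset α, ∀ l ∉ L, IsEmpty (B l) := by
  have hf : (Set.range (Sigma.fst : ((l : α) × B l) → α)).Finite := Set.finite_range _
  refine ⟨hf.toFinset, fun l hl => ⟨fun T => hl ?_⟩⟩
  rw [Set.Finite.mem_toFinset]
  exact ⟨⟨l, T⟩, rfl⟩

theorem finsum_sigma_eq_sum {α M : Type*} [AddCommMonoid M] {B : α → Type*} [∀ l, Fintype (B l)]
    {L : Finset α} (hL : ∀ l ∉ L, IsEmpty (B l)) (f : ((l : α) × B l) → M) :
    ∑ᶠ p, f p = ∑ l ∈ L, ∑ T, f ⟨l, T⟩ := by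
  rw [finsum_eq_sum_of_support_subset (s := L.sigma fun _ => Finset.univ), Finset.sum_sigma]
  rintro ⟨l, T⟩ -
  simp only [Finset.coe_sigma, Finset.coe_univ, Set.mem_sigma_iff, Finset.mem_coe, Set.mem_univ,
    and_true]
  by_contra hl
  exact (hL l hl).elim T

theorem finsum_eq_sum_of_forall_notMem {α M : Type*} [AddCommMonoid M] {L : Finset α} {f : α → M}
    (hL : ∀ l ∉ L, f l = 0) : ∑ᶠ l, f l = ∑ l ∈ L, f l :=
  finsum_eq_sum_of_support_subset f fun l hl => by
    by_contra h
    exact hl (hL l h)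

/-! ### Complete reducibility and the commutant -/

section Decompositions

variable {G : Type u} [Group G] [TopologicalSpace G] {κ : Type v} [Fintype κ] [DecidableEq κ]
  {σ : IrrepBasis G}

theorem IsDecomposition.finite_mult {ρ : G → Matrix κ κ ℂ} {B : UDual G → Type w}
    {W : (l : UDual G) → B l → Matrix (Fin (σ.d l)) κ ℂ} (h : IsDecomposition σ ρ B W)
    (l : UDual G) : Finite (B l) :=
  have := h.finite
  Finite.of_injective (Sigma.mk l) sigma_mk_injective

theorem IsDecomposition.sum_eq_one {ρ : G → Matrix κ κ ℂ} {B : UDual G → Type w}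
    [∀ l, Fintype (B l)]
    {W : (l : UDual G) → B l → Matrix (Fin (σ.d l)) κ ℂ} (h : IsDecomposition σ ρ B W)
    {L : Finset (UDual G)} (hL : ∀ l ∉ L, IsEmpty (B l)) :
    ∑ l ∈ L, ∑ T, (W l T)ᴴ * W l T = 1 := by
  rw [← h.complete, finsum_sigma_eq_sum hL]

omit [DecidableEq κ] in
/-- The first rows of orthonormal blocks are linearly independent. -/
theorem linearIndependent_rows {P : Type*} (l : P → UDual G)
    (W : (p : P) → Matrix (Fin (σ.d (l p))) κ ℂ) (h1 : ∀ p, W p * (W p)ᴴ = 1)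
    (h2 : ∀ p q, p ≠ q → W p * (W q)ᴴ = 0) :
    LinearIndependent ℂ fun p => W p ⟨0, σ.d_pos _⟩ := by
  rw [linearIndependent_iff']
  intro s c hc q hq
  have h : ∀ p, W p ⟨0, σ.d_pos _⟩ ⬝ᵥ star (W q ⟨0, σ.d_pos _⟩)
      = (W p * (W q)ᴴ) ⟨0, σ.d_pos _⟩ ⟨0, σ.d_pos _⟩ := fun p => rfl
  have h3 := congrArg (fun z => z ⬝ᵥ star (W q ⟨0, σ.d_pos _⟩)) hc
  simp only [sum_dotProduct, smul_dotProduct, h, zero_dotProduct] at h3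
  rw [Finset.sum_eq_single q] at h3
  · simpa [h1 q] using h3
  · intro p _ hp
    simp [h2 p q hp]
  · exact fun h => absurd hq h

/-- Schur makes `A * Aᴴ` scalar, and a diagonal entry of it is the squared norm of a nonzero row.
This allows a nonzero intertwiner to be normalized to a block. -/
theorem IsUnitaryRep.intertwiner_mul_conjTranspose {ρ : G → Matrix κ κ ℂ} (hρ : IsUnitaryRep ρ)
    {l : UDual G} {A : Matrix (Fin (σ.d l)) κ ℂ} (hA : ∀ g, A * ρ g = σ.mat l g * A) (h0 : A ≠ 0) :
    ∃ r : ℝ, 0 < r ∧ A * Aᴴ = (r : ℂ) • 1 := by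
  obtain ⟨c, hc⟩ := σ.schur_scalar l (A * Aᴴ) fun g => by
    rw [Matrix.mul_assoc, hρ.intertwines_conjTranspose (σ.isUnitaryRep l) hA, ← Matrix.mul_assoc,
      hA, Matrix.mul_assoc]
  obtain ⟨i, j, hij⟩ : ∃ i j, A i j ≠ 0 := by
    by_contra h
    push Not at h
    exact h0 (by ext i j; exact h i j)
  refine ⟨∑ k, ‖A i k‖ ^ 2, lt_of_lt_of_le (by positivity)
      (Finset.single_le_sum (f := fun k => ‖A i k‖ ^ 2) (fun k _ => by positivity)
        (Finset.mem_univ j)), ?_⟩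
  have := congrFun (congrFun hc i) i
  simp only [Matrix.mul_apply, Matrix.conjTranspose_apply, Matrix.smul_apply, Matrix.one_apply_eq,
    smul_eq_mul, mul_one] at this
  rw [hc, ← this]
  push_cast
  congr 1
  exact Finset.sum_congr rfl fun k _ => Complex.mul_conj' _

/-- An orthonormal family of intertwiners which cannot be enlarged is a decomposition. -/
theorem IsUnitaryRep.isDecomposition_of_maximal {ρ : G → Matrix κ κ ℂ} (hρ : IsUnitaryRep ρ)
    {B : UDual G → Type w} {W : (l : UDual G) → B l → Matrix (Fin (σ.d l)) κ ℂ}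
    (hint : ∀ l T g, W l T * ρ g = σ.mat l g * W l T)
    (hnorm : ∀ l T, W l T * (W l T)ᴴ = 1)
    (horth : ∀ l T S, T ≠ S → W l T * (W l S)ᴴ = 0)
    (hmax : ∀ l (A : Matrix (Fin (σ.d l)) κ ℂ), (∀ g, A * ρ g = σ.mat l g * A) →
      (∀ T, A * (W l T)ᴴ = 0) → A = 0) :
    IsDecomposition σ ρ B W := by
  have hint' : ∀ l T g, (W l T)ᴴ * σ.mat l g = ρ g * (W l T)ᴴ := fun l T g =>
    hρ.intertwines_conjTranspose (σ.isUnitaryRep l) (hint l T) g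
  have hirr : ∀ l l' T S, l ≠ l' → W l T * (W l' S)ᴴ = 0 := fun l l' T S hl =>
    σ.schur_zero hl _ fun g => by
      rw [Matrix.mul_assoc, hint', ← Matrix.mul_assoc, hint, Matrix.mul_assoc]
  -- One row from each block gives an independent family in the finite-dimensional space `κ → ℂ`.
  have hfin : Finite ((l : UDual G) × B l) := by
    refine (linearIndependent_rows (fun p : (l : UDual G) × B l => p.1) (fun p => W p.1 p.2)
      (fun p => hnorm _ _) ?_).finite_of_isNoetherian
    rintro ⟨l, T⟩ ⟨l', S⟩ hp
    by_cases hl : l = l'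
    · subst hl
      exact horth _ _ _ fun h => hp (congrArg (Sigma.mk l) h)
    · exact hirr _ _ _ _ hl
  refine ⟨hfin, hint, hnorm, horth, hirr, ?_⟩
  have := Fintype.ofFinite ((l : UDual G) × B l)
  rw [finsum_eq_sum_of_fintype]
  -- `Q` is the invariant orthogonal projection onto the part already decomposed. If `Q ≠ 1`, the
  -- range of `1 - Q` contains an irrep, whose intertwiner is orthogonal to all blocks and
  -- contradicts `hmax`.
  set Q : Matrix κ κ ℂ := ∑ p : (l : UDual G) × B l, (W p.1 p.2)ᴴ * W p.1 p.2 with hQ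
  have hWQ : ∀ l T, W l T * Q = W l T := fun l T => by
    rw [hQ, Matrix.mul_sum, Finset.sum_eq_single ⟨l, T⟩]
    · rw [← Matrix.mul_assoc, hnorm, Matrix.one_mul]
    · rintro ⟨l', S⟩ - hp
      rw [← Matrix.mul_assoc]
      by_cases hl : l = l'
      · subst hl
        rw [horth l T S fun h => hp (congrArg (Sigma.mk l) h.symm), Matrix.zero_mul]
      · rw [hirr _ _ _ _ hl, Matrix.zero_mul]
    · simp
  have hcomm : ∀ g, ρ g * Q = Q * ρ g := fun g => by
    rw [hQ, Matrix.mul_sum, Matrix.sum_mul]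
    refine Finset.sum_congr rfl fun p _ => ?_
    rw [← Matrix.mul_assoc, ← hint', Matrix.mul_assoc, Matrix.mul_assoc, hint]
  by_contra hne
  obtain ⟨l, A, hA1, hA2, hA3⟩ := hρ.exists_irrep σ (LinearMap.range (1 - Q).mulVecLin)
    (by
      rintro g _ ⟨v, rfl⟩
      refine ⟨ρ g *ᵥ v, ?_⟩
      rw [Matrix.mulVecLin_apply, Matrix.mulVecLin_apply, Matrix.mulVec_mulVec,
        Matrix.mulVec_mulVec, Matrix.sub_mul, Matrix.mul_sub, Matrix.one_mul, Matrix.mul_one,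
        hcomm])
    (by
      intro h
      rw [LinearMap.range_eq_bot] at h
      apply hne
      have h1 : (1 - Q : Matrix κ κ ℂ) = 0 := by
        apply Matrix.ext_of_mulVec_single
        intro i
        rw [Matrix.zero_mulVec]
        exact LinearMap.congr_fun h (Pi.single i 1)
      exact (sub_eq_zero.1 h1).symm)
  have hA0 : A = 0 := hmax l A hA2 fun T => by
    have h1 : W l T * Aᴴ = 0 := by
      apply Matrix.ext_of_mulVec_single
      intro i
      obtain ⟨v, hv⟩ := hA3 (Pi.single i 1)
      rw [← Matrix.mulVec_mulVec, ← hv, Matrix.mulVecLin_apply, Matrix.mulVec_mulVec,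
        Matrix.mul_sub, hWQ, Matrix.mul_one, sub_self, Matrix.zero_mulVec, Matrix.zero_mulVec]
    have h2 := congrArg Matrix.conjTranspose h1
    simpa [Matrix.conjTranspose_mul] using h2
  have h1 := congrFun (congrFun hA1 ⟨0, σ.d_pos l⟩) ⟨0, σ.d_pos l⟩
  simp [hA0] at h1

/-- Complete reducibility. -/
theorem IsUnitaryRep.exists_decomposition (σ : IrrepBasis G) {ρ : G → Matrix κ κ ℂ}
    (hρ : IsUnitaryRep ρ) :
    ∃ (m : UDual G → ℕ) (W : (l : UDual G) → Fin (m l) → Matrix (Fin (σ.d l)) κ ℂ),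
      IsDecomposition σ ρ (fun l => Fin (m l)) W := by
  have key : ∀ l : UDual G, ∃ (m : ℕ) (W : Fin m → Matrix (Fin (σ.d l)) κ ℂ),
      (∀ T g, W T * ρ g = σ.mat l g * W T) ∧ (∀ T, W T * (W T)ᴴ = 1) ∧
      (∀ T S, T ≠ S → W T * (W S)ᴴ = 0) ∧
      ∀ A : Matrix (Fin (σ.d l)) κ ℂ, (∀ g, A * ρ g = σ.mat l g * A) →
        (∀ T, A * (W T)ᴴ = 0) → A = 0 := by
    intro l
    -- The possible sizes of orthonormal families at the label `l`. Independence of rows bounds them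
    -- by the dimension, so a largest family exists. Labels can be treated separately since blocks
    -- of different irreps are orthogonal by Schur.
    let s : Set ℕ := {m | ∃ W : Fin m → Matrix (Fin (σ.d l)) κ ℂ,
      (∀ T g, W T * ρ g = σ.mat l g * W T) ∧ (∀ T, W T * (W T)ᴴ = 1) ∧
      (∀ T S, T ≠ S → W T * (W S)ᴴ = 0)}
    have hs : s.Nonempty := ⟨0, Fin.elim0, fun T => T.elim0, fun T => T.elim0, fun T => T.elim0⟩
    have hb : BddAbove s := by
      refine ⟨Fintype.card κ, ?_⟩
      rintro m ⟨W, -, h1, h2⟩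
      have := (linearIndependent_rows (fun _ : Fin m => l) W h1 h2).fintype_card_le_finrank
      simpa using this
    obtain ⟨W, hi, h1, h2⟩ := Nat.sSup_mem hs hb
    refine ⟨sSup s, W, hi, h1, h2, fun A hA hAW => ?_⟩
    by_contra hne
    obtain ⟨r, hr, hAA⟩ := hρ.intertwiner_mul_conjTranspose hA hne
    -- A nonzero intertwiner orthogonal to the family would enlarge it after division by `√r`.
    have hmem : sSup s + 1 ∈ s := by
      have hWA : ∀ T, W T * Aᴴ = 0 := fun T => by
        simpa [Matrix.conjTranspose_mul] using congrArg Matrix.conjTranspose (hAW T)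
      refine ⟨Fin.cons (((Real.sqrt r : ℂ)⁻¹) • A) W, fun T g => ?_, fun T => ?_, fun T S hTS => ?_⟩
      · refine Fin.cases ?_ (fun T => ?_) T
        · rw [Fin.cons_zero, Matrix.smul_mul, Matrix.mul_smul, hA]
        · rw [Fin.cons_succ, hi]
      · refine Fin.cases ?_ (fun T => ?_) T
        · rw [Fin.cons_zero, Matrix.conjTranspose_smul, Matrix.smul_mul, Matrix.mul_smul, hAA,
            smul_smul, smul_smul, star_inv₀, RCLike.star_def, Complex.conj_ofReal]
          have h0 : (Real.sqrt r : ℂ) ≠ 0 := by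
            exact_mod_cast (Real.sqrt_pos.2 hr).ne'
          have h1 : (r : ℂ) = (Real.sqrt r : ℂ) * Real.sqrt r := by
            rw [← Complex.ofReal_mul, Real.mul_self_sqrt hr.le]
          rw [h1]
          have : (Real.sqrt r : ℂ)⁻¹ * (Real.sqrt r : ℂ)⁻¹ * ((Real.sqrt r : ℂ) * Real.sqrt r)
              = 1 := by field_simp
          rw [this, one_smul]
        · rw [Fin.cons_succ, h1]
      · induction T using Fin.cases with
        | zero =>
          induction S using Fin.cases with
          | zero => exact absurd rfl hTS
          | succ S => rw [Fin.cons_zero, Fin.cons_succ, Matrix.smul_mul, hAW, smul_zero]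
        | succ T =>
          induction S using Fin.cases with
          | zero =>
            rw [Fin.cons_zero, Fin.cons_succ, Matrix.conjTranspose_smul, Matrix.mul_smul, hWA,
              smul_zero]
          | succ S =>
            rw [Fin.cons_succ, Fin.cons_succ, h2 _ _ fun h => hTS (by rw [h])]
    exact absurd (le_csSup hb hmem) (by simp)
  choose m W hi h1 h2 h3 using key
  exact ⟨m, W, hρ.isDecomposition_of_maximal hi h1 h2 h3⟩

/-- The matrix units of a decomposition span the commutant. -/
theorem IsDecomposition.isCommutantMatrixUnits {ρ : G → Matrix κ κ ℂ} {B : UDual G → Type w}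
    {W : (l : UDual G) → B l → Matrix (Fin (σ.d l)) κ ℂ} (h : IsDecomposition σ ρ B W) :
    IsCommutantMatrixUnits ρ B (matUnit W) := by
  obtain ⟨L, hL⟩ := exists_finset_isEmpty h.finite
  have (l : UDual G) : Finite (B l) := h.finite_mult l
  have (l : UDual G) : Fintype (B l) := Fintype.ofFinite _
  have hc := h.sum_eq_one hL
  -- Here `ρ` is not assumed unitary, so the adjoint relation is extracted from completeness and
  -- orthogonality of the blocks.
  have hint' : ∀ l T g, ρ g * (W l T)ᴴ = (W l T)ᴴ * σ.mat l g := fun l T g => by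
    classical
    calc ρ g * (W l T)ᴴ = (∑ l ∈ L, ∑ T, (W l T)ᴴ * W l T) * (ρ g * (W l T)ᴴ) := by
          rw [hc, Matrix.one_mul]
      _ = ∑ l' ∈ L, ∑ S, ((W l' S)ᴴ * σ.mat l' g) * (W l' S * (W l T)ᴴ) := by
          simp only [Matrix.sum_mul]
          refine Finset.sum_congr rfl fun l' _ => Finset.sum_congr rfl fun S _ => ?_
          rw [Matrix.mul_assoc, ← Matrix.mul_assoc (W l' S), h.intertwines, Matrix.mul_assoc,
            Matrix.mul_assoc]
      _ = (W l T)ᴴ * σ.mat l g := by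
          rw [Finset.sum_eq_single l, Finset.sum_eq_single T, h.norm_block, Matrix.mul_one]
          · intro S _ hS
            rw [h.orth_mult _ _ _ hS, Matrix.mul_zero]
          · simp
          · intro l' _ hl
            refine Finset.sum_eq_zero fun S _ => ?_
            rw [h.orth_irrep _ _ _ _ hl, Matrix.mul_zero]
          · intro hl
            exact ((hL l hl).elim T)
  refine ⟨fun l T S h0 => ?_, fun l T S => ?_, fun l T S U => ?_, fun l T S S' U hS => ?_,
    fun l l' T S T' S' hl => ?_, ?_⟩
  · have h1 : W l T * matUnit W l T S * (W l S)ᴴ = 1 := by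
      rw [matUnit, ← Matrix.mul_assoc, h.norm_block, Matrix.one_mul, h.norm_block]
    rw [h0, Matrix.mul_zero, Matrix.zero_mul] at h1
    simpa using congrFun (congrFun h1 ⟨0, σ.d_pos l⟩) ⟨0, σ.d_pos l⟩
  · rw [matUnit, Matrix.conjTranspose_mul, Matrix.conjTranspose_conjTranspose, matUnit]
  · rw [matUnit, matUnit, Matrix.mul_assoc, ← Matrix.mul_assoc (W l S), h.norm_block,
      Matrix.one_mul, matUnit]
  · rw [matUnit, matUnit, Matrix.mul_assoc, ← Matrix.mul_assoc (W l S), h.orth_mult _ _ _ hS,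
      Matrix.zero_mul, Matrix.mul_zero]
  · rw [matUnit, matUnit, Matrix.mul_assoc, ← Matrix.mul_assoc (W l S), h.orth_irrep _ _ _ _ hl,
      Matrix.zero_mul, Matrix.mul_zero]
  · ext X
    simp only [SetLike.mem_coe, Set.mem_ofPred_eq]
    constructor
    · intro hX g
      induction hX using Submodule.span_induction with
      | mem X hX =>
        obtain ⟨l, T, S, rfl⟩ := hX
        rw [matUnit, Matrix.mul_assoc, h.intertwines, ← Matrix.mul_assoc, ← hint',
          Matrix.mul_assoc]
      | zero => simp
      | add X Y _ _ hX hY => rw [Matrix.add_mul, Matrix.mul_add, hX, hY]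
      | smul c X _ hX => rw [Matrix.smul_mul, Matrix.mul_smul, hX]
    · intro hX
      -- `X` between two resolutions of the identity. The middle factors are intertwiners between
      -- irreps: zero for `l ≠ l'`, scalar for `l = l'`.
      have hexp : X = ∑ l ∈ L, ∑ T, ∑ l' ∈ L, ∑ S,
          (W l T)ᴴ * (W l T * X * (W l' S)ᴴ) * W l' S := by
        calc X = (∑ l ∈ L, ∑ T, (W l T)ᴴ * W l T) * X * (∑ l ∈ L, ∑ T, (W l T)ᴴ * W l T) := by
              rw [hc, Matrix.one_mul, Matrix.mul_one]
          _ = _ := by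
              rw [Matrix.sum_mul, Matrix.sum_mul]
              refine Finset.sum_congr rfl fun l _ => ?_
              rw [Matrix.sum_mul, Matrix.sum_mul]
              refine Finset.sum_congr rfl fun T _ => ?_
              rw [Matrix.mul_sum]
              refine Finset.sum_congr rfl fun l' _ => ?_
              rw [Matrix.mul_sum]
              refine Finset.sum_congr rfl fun S _ => ?_
              simp only [Matrix.mul_assoc]
      rw [hexp]
      refine Submodule.sum_mem _ fun l _ => Submodule.sum_mem _ fun T _ =>
        Submodule.sum_mem _ fun l' _ => Submodule.sum_mem _ fun S _ => ?_
      have hY : ∀ g, W l T * X * (W l' S)ᴴ * σ.mat l' g = σ.mat l g * (W l T * X * (W l' S)ᴴ) :=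
        fun g => by
          rw [Matrix.mul_assoc, ← hint', ← Matrix.mul_assoc, Matrix.mul_assoc (W l T), hX,
            ← Matrix.mul_assoc, h.intertwines]
          simp only [Matrix.mul_assoc]
      by_cases hl : l = l'
      · subst hl
        obtain ⟨c, hc⟩ := σ.schur_scalar l _ hY
        rw [hc, Matrix.mul_smul, Matrix.mul_one, Matrix.smul_mul]
        exact Submodule.smul_mem _ _ (Submodule.subset_span ⟨l, T, S, rfl⟩)
      · rw [σ.schur_zero hl _ hY, Matrix.mul_zero, Matrix.zero_mul]
        exact Submodule.zero_mem _

end Decompositions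

/-! ### Schur orthogonality and Haar averages -/

section Haar

variable {G : Type u} [Group G] [TopologicalSpace G] [IsTopologicalGroup G] [CompactSpace G]
  [MeasurableSpace G] [BorelSpace G] (μ : Measure G) [μ.IsHaarMeasure] [IsProbabilityMeasure μ]
  (σ : IrrepBasis G)

theorem integrable_of_continuous {G : Type u} [TopologicalSpace G] [CompactSpace G]
    [MeasurableSpace G] [BorelSpace G] (μ : Measure G) [IsFiniteMeasure μ] {f : G → ℂ} (hf : Continuous f) :
    Integrable f μ := by
  obtain ⟨C, hC⟩ := (isCompact_range hf).isBounded.exists_norm_le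
  exact Integrable.of_bound hf.aestronglyMeasurable C
    (Filter.Eventually.of_forall fun g => hC _ ⟨g, rfl⟩)

omit [IsTopologicalGroup G] [CompactSpace G] [MeasurableSpace G] [BorelSpace G] in
theorem IrrepBasis.continuous_entry (l : UDual G) (M N : Fin (σ.d l)) :
    Continuous fun g => σ.mat l g M N :=
  (σ.isUnitaryRep l).continuous.matrix_elem M N

/-- The average of `R_l(g) E_{N N'} R_{l'}(g)†`. -/
def haarAverage (l l' : UDual G) (N : Fin (σ.d l)) (N' : Fin (σ.d l')) :
    Matrix (Fin (σ.d l)) (Fin (σ.d l')) ℂ :=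
  Matrix.of fun M M' => ∫ g, σ.mat l g M N * conj (σ.mat l' g M' N') ∂μ

omit [IsProbabilityMeasure μ] in
-- Left invariance of the measure: replacing `g` by `h * g` conjugates the average by `h` without
-- changing it.
theorem haarAverage_intertwines [IsFiniteMeasure μ] (l l' : UDual G) (N : Fin (σ.d l))
    (N' : Fin (σ.d l')) (h : G) :
    haarAverage μ σ l l' N N' * σ.mat l' h = σ.mat l h * haarAverage μ σ l l' N N' := by
  have key : σ.mat l h * haarAverage μ σ l l' N N' * (σ.mat l' h)ᴴ = haarAverage μ σ l l' N N' := by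
    ext M M'
    simp only [Matrix.mul_apply, haarAverage, Matrix.of_apply, Matrix.conjTranspose_apply,
      Finset.sum_mul]
    rw [← integral_mul_left_eq_self _ h]
    have hexp : ∀ g, σ.mat l (h * g) M N * conj (σ.mat l' (h * g) M' N') =
        ∑ K', ∑ K, σ.mat l h M K * (σ.mat l g K N * conj (σ.mat l' g K' N')) *
          star (σ.mat l' h M' K') := fun g => by
      rw [(σ.isUnitaryRep l).map_mul, (σ.isUnitaryRep l').map_mul, Matrix.mul_apply,
        Matrix.mul_apply, map_sum, Finset.sum_mul_sum, Finset.sum_comm]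
      refine Finset.sum_congr rfl fun K' _ => Finset.sum_congr rfl fun K _ => ?_
      rw [map_mul, RCLike.star_def]
      ring
    simp only [hexp]
    have hI : ∀ (K : Fin (σ.d l)) (K' : Fin (σ.d l')), Integrable (fun g => σ.mat l h M K *
        (σ.mat l g K N * conj (σ.mat l' g K' N')) * star (σ.mat l' h M' K')) μ := fun K K' =>
      integrable_of_continuous μ ((continuous_const.mul ((σ.continuous_entry l K N).mul
        (Complex.continuous_conj.comp (σ.continuous_entry l' K' N')))).mul continuous_const)
    rw [integral_finsetSum _ fun K' _ => integrable_finsetSum _ fun K _ => hI K K']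
    refine Finset.sum_congr rfl fun K' _ => ?_
    rw [integral_finsetSum _ fun K _ => hI K K']
    refine Finset.sum_congr rfl fun K _ => ?_
    rw [integral_mul_const, integral_const_mul]
  conv_lhs => rw [← key]
  rw [Matrix.mul_assoc, (σ.isUnitaryRep l').conjTranspose_mul, Matrix.mul_one]

theorem schur_orthogonality_ne {l l' : UDual G} (hl : l ≠ l') (M N : Fin (σ.d l))
    (M' N' : Fin (σ.d l')) : ∫ g, σ.mat l g M N * conj (σ.mat l' g M' N') ∂μ = 0 :=
  congrFun (congrFun (σ.schur_zero hl _ (haarAverage_intertwines μ σ l l' N N')) M) M'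

/-- The average is a scalar matrix by Schur; its trace, computed under the integral from unitarity
of the columns, determines the scalar. -/
theorem schur_orthogonality_eq (l : UDual G) (M N M' N' : Fin (σ.d l)) :
    ∫ g, σ.mat l g M N * conj (σ.mat l g M' N') ∂μ
      = if M = M' ∧ N = N' then (σ.d l : ℂ)⁻¹ else 0 := by
  obtain ⟨c, hc⟩ := σ.schur_scalar l _ (haarAverage_intertwines μ σ l l N N')
  have h1 : ∀ M M', ∫ g, σ.mat l g M N * conj (σ.mat l g M' N') ∂μ = if M = M' then c else 0 :=
    fun M M' => by
      have := congrFun (congrFun hc M) M'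
      rw [haarAverage, Matrix.of_apply] at this
      rw [this, Matrix.smul_apply, Matrix.one_apply, smul_eq_mul, mul_ite, mul_one, mul_zero]
  have h2 : (σ.d l : ℂ) * c = if N = N' then 1 else 0 := by
    calc (σ.d l : ℂ) * c = ∑ M : Fin (σ.d l), ∫ g, σ.mat l g M N * conj (σ.mat l g M N') ∂μ := by
          simp [h1]
      _ = ∫ g, ∑ M : Fin (σ.d l), σ.mat l g M N * conj (σ.mat l g M N') ∂μ := by
          rw [integral_finsetSum]
          exact fun K _ => integrable_of_continuous μ ((σ.continuous_entry l K N).mul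
            (Complex.continuous_conj.comp (σ.continuous_entry l K N')))
      _ = ∫ _, (if N = N' then 1 else 0 : ℂ) ∂μ := by
          congr 1
          ext g
          have := congrFun (congrFun ((σ.isUnitaryRep l).conjTranspose_mul g) N') N
          rw [Matrix.mul_apply, Matrix.one_apply] at this
          simp only [Matrix.conjTranspose_apply, RCLike.star_def] at this
          simp only [eq_comm (a := N)]
          rw [← this]
          exact Finset.sum_congr rfl fun K _ => mul_comm _ _
      _ = _ := by simp
  have hd : (σ.d l : ℂ) ≠ 0 := by exact_mod_cast (σ.d_pos l).ne'
  rw [h1]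
  by_cases hN : N = N'
  · rw [if_pos hN] at h2
    have : c = (σ.d l : ℂ)⁻¹ := eq_inv_of_mul_eq_one_right h2
    simp [hN, this]
  · rw [if_neg hN] at h2
    have : c = 0 := (mul_eq_zero.1 h2).resolve_left hd
    simp [hN, this]

variable {σ} {κ : Type v} [Fintype κ] [DecidableEq κ]

/-- The Haar average of products of matrix elements, through any decomposition. -/
theorem IsDecomposition.integral_eq {ρ : G → Matrix κ κ ℂ} {B : UDual G → Type w}
    {W : (l : UDual G) → B l → Matrix (Fin (σ.d l)) κ ℂ} (h : IsDecomposition σ ρ B W)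
    (a b a' b' : κ) :
    ∫ g, ρ g b a * conj (ρ g b' a') ∂μ = ∑ᶠ l : UDual G, (σ.d l : ℂ)⁻¹ *
      ∑ᶠ T : B l, ∑ᶠ S : B l, matUnit W l T S a' a * conj (matUnit W l T S b' b) := by
  obtain ⟨L, hL⟩ := exists_finset_isEmpty h.finite
  have (l : UDual G) : Finite (B l) := h.finite_mult l
  have (l : UDual G) : Fintype (B l) := Fintype.ofFinite _
  simp only [finsum_eq_sum_of_fintype]
  rw [finsum_eq_sum_of_forall_notMem (L := L) fun l hl => by
    have := hL l hl
    simp]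
  have hρ : ∀ g b a, ρ g b a = ∑ l ∈ L, ∑ T, ∑ M, ∑ N,
      (conj (W l T M b) * W l T N a) * σ.mat l g M N := fun g b a => by
    have h1 : ρ g = ∑ l ∈ L, ∑ T, (W l T)ᴴ * (σ.mat l g * W l T) := by
      calc ρ g = (∑ l ∈ L, ∑ T, (W l T)ᴴ * W l T) * ρ g := by rw [h.sum_eq_one hL, Matrix.one_mul]
        _ = _ := by simp only [Matrix.sum_mul, Matrix.mul_assoc, h.intertwines]
    rw [h1]
    simp only [Matrix.sum_apply, Matrix.mul_apply, Matrix.conjTranspose_apply, RCLike.star_def,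
      Finset.mul_sum]
    refine Finset.sum_congr rfl fun l _ => Finset.sum_congr rfl fun T _ =>
      Finset.sum_congr rfl fun M _ => Finset.sum_congr rfl fun N _ => by ring
  have hprod : ∀ g, ρ g b a * conj (ρ g b' a') = ∑ l ∈ L, ∑ l' ∈ L, ∑ T, ∑ S : B l', ∑ M, ∑ M',
      ∑ N, ∑ N', ((conj (W l T M b) * W l T N a) * conj (conj (W l' S M' b') * W l' S N' a')) *
        (σ.mat l g M N * conj (σ.mat l' g M' N')) := fun g => by
    rw [hρ, hρ, map_sum, Finset.sum_mul_sum]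
    refine Finset.sum_congr rfl fun l _ => Finset.sum_congr rfl fun l' _ => ?_
    rw [map_sum, Finset.sum_mul_sum]
    refine Finset.sum_congr rfl fun T _ => Finset.sum_congr rfl fun S _ => ?_
    rw [map_sum, Finset.sum_mul_sum]
    refine Finset.sum_congr rfl fun M _ => Finset.sum_congr rfl fun M' _ => ?_
    rw [map_sum, Finset.sum_mul_sum]
    refine Finset.sum_congr rfl fun N _ => Finset.sum_congr rfl fun N' _ => ?_
    rw [map_mul]
    ring
  have hcont : ∀ (l l' : UDual G) (M N : Fin (σ.d l)) (M' N' : Fin (σ.d l')) (c : ℂ),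
      Continuous fun g => c * (σ.mat l g M N * conj (σ.mat l' g M' N')) := fun l l' M N M' N' c =>
    continuous_const.mul ((σ.continuous_entry l M N).mul
      (Complex.continuous_conj.comp (σ.continuous_entry l' M' N')))
  simp only [hprod]
  rw [integral_finsetSum _ fun l _ => integrable_of_continuous μ (by
    repeat' refine continuous_finsetSum _ fun _ _ => ?_
    exact hcont _ _ _ _ _ _ _)]
  refine Finset.sum_congr rfl fun l hl => ?_
  have hterm : ∀ l' : UDual G, (∫ g, ∑ T, ∑ S : B l', ∑ M, ∑ M', ∑ N, ∑ N',
      ((conj (W l T M b) * W l T N a) * conj (conj (W l' S M' b') * W l' S N' a')) *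
        (σ.mat l g M N * conj (σ.mat l' g M' N')) ∂μ) = ∑ T, ∑ S : B l', ∑ M, ∑ M', ∑ N, ∑ N',
      ((conj (W l T M b) * W l T N a) * conj (conj (W l' S M' b') * W l' S N' a')) *
        ∫ g, (σ.mat l g M N * conj (σ.mat l' g M' N')) ∂μ := fun l' => by
    rw [integral_finsetSum _ fun _ _ => integrable_of_continuous μ (by
      repeat' refine continuous_finsetSum _ fun _ _ => ?_
      exact hcont _ _ _ _ _ _ _)]
    refine Finset.sum_congr rfl fun T _ => ?_
    rw [integral_finsetSum _ fun _ _ => integrable_of_continuous μ (by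
      repeat' refine continuous_finsetSum _ fun _ _ => ?_
      exact hcont _ _ _ _ _ _ _)]
    refine Finset.sum_congr rfl fun S _ => ?_
    rw [integral_finsetSum _ fun _ _ => integrable_of_continuous μ (by
      repeat' refine continuous_finsetSum _ fun _ _ => ?_
      exact hcont _ _ _ _ _ _ _)]
    refine Finset.sum_congr rfl fun M _ => ?_
    rw [integral_finsetSum _ fun _ _ => integrable_of_continuous μ (by
      repeat' refine continuous_finsetSum _ fun _ _ => ?_
      exact hcont _ _ _ _ _ _ _)]
    refine Finset.sum_congr rfl fun M' _ => ?_
    rw [integral_finsetSum _ fun _ _ => integrable_of_continuous μ (by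
      repeat' refine continuous_finsetSum _ fun _ _ => ?_
      exact hcont _ _ _ _ _ _ _)]
    refine Finset.sum_congr rfl fun N _ => ?_
    rw [integral_finsetSum _ fun _ _ => integrable_of_continuous μ (hcont _ _ _ _ _ _ _)]
    refine Finset.sum_congr rfl fun N' _ => ?_
    rw [integral_const_mul]
  rw [integral_finsetSum _ fun l _ => integrable_of_continuous μ (by
    repeat' refine continuous_finsetSum _ fun _ _ => ?_
    exact hcont _ _ _ _ _ _ _)]
  rw [Finset.sum_eq_single_of_mem l hl fun l' _ hne => by
    rw [hterm]
    simp only [schur_orthogonality_ne μ σ (Ne.symm hne), mul_zero, Finset.sum_const_zero]]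
  -- The block of the complex conjugated factor supplies the row label of the matrix unit, hence the
  -- exchange of the two sums. The remaining Kronecker deltas leave independent sums over `N` and
  -- `M`, one for each matrix unit.
  rw [hterm, Finset.sum_comm, Finset.mul_sum]
  refine Finset.sum_congr rfl fun S _ => ?_
  rw [Finset.mul_sum]
  refine Finset.sum_congr rfl fun T _ => ?_
  simp only [schur_orthogonality_eq, ite_and, mul_ite, mul_zero, Finset.sum_ite_eq,
    Finset.mem_univ, if_true, Finset.sum_ite_irrel, Finset.sum_const_zero]
  simp only [matUnit, Matrix.mul_apply, Matrix.conjTranspose_apply, RCLike.star_def, map_sum]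
  rw [Finset.sum_mul_sum, Finset.sum_comm, Finset.mul_sum]
  refine Finset.sum_congr rfl fun N _ => ?_
  rw [Finset.mul_sum]
  refine Finset.sum_congr rfl fun M _ => ?_
  simp only [map_mul, Complex.conj_conj]
  ring

end Haar

/-! ### Existence and uniqueness of Clebsch–Gordan transforms and their duals -/

section ClebschGordan

variable {G : Type u} [Group G] [TopologicalSpace G] {ι : Type v} [Fintype ι] [DecidableEq ι]
  {σ : IrrepBasis G}

theorem IsUnitaryRep.map_star {ρ : G → Matrix ι ι ℂ} (hρ : IsUnitaryRep ρ) :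
    IsUnitaryRep fun g => (ρ g).map star where
  continuous := hρ.continuous.matrix_map continuous_star
  map_one := by rw [hρ.map_one]; exact Matrix.map_one _ (star_zero _) (star_one _)
  map_mul g h := by rw [hρ.map_mul]; exact Matrix.map_mul (f := starRingEnd ℂ)
  map_inv g := by rw [hρ.map_inv]; rfl

theorem IsUnitaryRep.kronecker {κ : Type w} [Fintype κ] [DecidableEq κ] {ρ : G → Matrix κ κ ℂ}
    {τ : G → Matrix ι ι ℂ} (hρ : IsUnitaryRep ρ) (hτ : IsUnitaryRep τ) :
    IsUnitaryRep fun g => ρ g ⊗ₖ τ g where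
  continuous := continuous_matrix fun i j =>
    (hρ.continuous.matrix_elem i.1 j.1).mul (hτ.continuous.matrix_elem i.2 j.2)
  map_one := by rw [hρ.map_one, hτ.map_one, Matrix.one_kronecker_one]
  map_mul g h := by rw [hρ.map_mul, hτ.map_mul, Matrix.mul_kronecker_mul]
  map_inv g := by rw [hρ.map_inv, hτ.map_inv, Matrix.conjTranspose_kronecker]

theorem exists_isCG (σ : IrrepBasis G) {ρ : G → Matrix ι ι ℂ} (hρ : IsUnitaryRep ρ) :
    ∃ (m : UDual G → UDual G → ℕ) (C : CGTensor σ ι m), IsCG σ ρ m C := by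
  choose m C hC using fun l => ((σ.isUnitaryRep l).kronecker hρ).exists_decomposition σ
  exact ⟨m, C, hC⟩

/-- The adjoint of a tensor `V₁ ⊗ V → V₂` with the wire `V` bent, as a tensor `V₂ ⊗ V̄ → V₁`. -/
def bend {a b : ℕ} (A : Matrix (Fin b) (Fin a × ι) ℂ) : Matrix (Fin a) (Fin b × ι) ℂ :=
  Matrix.of fun N p => conj (A p.1 (N, p.2))

omit [Fintype ι] [DecidableEq ι] in
theorem bend_bend {a b : ℕ} (A : Matrix (Fin b) (Fin a × ι) ℂ) : bend (bend A) = A := by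
  ext M ⟨N, x⟩
  simp [bend]

omit [DecidableEq ι] in
-- Bending preserves the set of entries up to conjugation, hence the Hilbert–Schmidt pairing up to
-- exchange of its arguments. This transports orthogonality between `C` and its dual.
theorem trace_bend_mul {a b : ℕ} (A B : Matrix (Fin b) (Fin a × ι) ℂ) :
    (bend A * (bend B)ᴴ).trace = (B * Aᴴ).trace := by
  simp only [Matrix.trace, Matrix.diag_apply, Matrix.mul_apply, bend, Matrix.of_apply,
    Matrix.conjTranspose_apply, RCLike.star_def, Complex.conj_conj, Fintype.sum_prod_type]
  rw [Finset.sum_comm]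
  exact Finset.sum_congr rfl fun M _ => Finset.sum_congr rfl fun N _ =>
    Finset.sum_congr rfl fun x _ => mul_comm _ _

omit [DecidableEq ι] in
theorem bend_intertwines {ρ : G → Matrix ι ι ℂ} {l l' : UDual G}
    {A : Matrix (Fin (σ.d l')) (Fin (σ.d l) × ι) ℂ}
    (hA : ∀ g, A * (σ.mat l g ⊗ₖ ρ g) = σ.mat l' g * A) (g : G) :
    bend A * (σ.mat l' g ⊗ₖ (ρ g).map star) = σ.mat l g * bend A := by
  -- Slicing along `V` turns the relation into `∑ y, ρ(g)_{yx} S_y R_l(g) = R_l'(g) S_x`. Moving the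
  -- two irreps to the opposite sides and taking adjoints gives the relation for the bent tensor.
  let S : ι → Matrix (Fin (σ.d l')) (Fin (σ.d l)) ℂ := fun x => A.submatrix id fun M => (M, x)
  have h1 : ∀ x, ∑ y, ρ g y x • (S y * σ.mat l g) = σ.mat l' g * S x := fun x => by
    ext M N
    have := congrFun (congrFun (hA g) M) (N, x)
    simp only [Matrix.mul_apply, Matrix.kroneckerMap_apply, Fintype.sum_prod_type] at this
    rw [Finset.sum_comm] at this
    simp only [Matrix.sum_apply, Matrix.smul_apply, Matrix.mul_apply, smul_eq_mul, S,
      Matrix.submatrix_apply, id]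
    rw [← this]
    refine Finset.sum_congr rfl fun y _ => ?_
    rw [Finset.mul_sum]
    exact Finset.sum_congr rfl fun K _ => by ring
  have h2 : ∀ x, ∑ y, conj (ρ g y x) • ((S y)ᴴ * σ.mat l' g) = σ.mat l g * (S x)ᴴ := fun x => by
    have h3 : ∑ y, ρ g y x • ((σ.mat l' g)ᴴ * S y) = S x * (σ.mat l g)ᴴ := by
      have h4 := congrArg (fun Z => (σ.mat l' g)ᴴ * Z * (σ.mat l g)ᴴ) (h1 x)
      simp only [Matrix.mul_sum, Matrix.sum_mul, Matrix.mul_smul, Matrix.smul_mul] at h4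
      rw [← Matrix.mul_assoc, (σ.isUnitaryRep l').conjTranspose_mul, Matrix.one_mul] at h4
      rw [← h4]
      refine Finset.sum_congr rfl fun y _ => ?_
      rw [Matrix.mul_assoc, Matrix.mul_assoc, (σ.isUnitaryRep l).mul_conjTranspose, Matrix.mul_one]
    have h5 := congrArg Matrix.conjTranspose h3
    simpa only [Matrix.conjTranspose_sum, Matrix.conjTranspose_smul, Matrix.conjTranspose_mul,
      Matrix.conjTranspose_conjTranspose, RCLike.star_def] using h5
  ext N ⟨M, x⟩
  have := congrFun (congrFun (h2 x) N) M
  simp only [Matrix.sum_apply, Matrix.smul_apply, Matrix.mul_apply, smul_eq_mul, S,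
    Matrix.submatrix_apply, id, Matrix.conjTranspose_apply] at this
  simp only [Matrix.mul_apply, Matrix.kroneckerMap_apply, Fintype.sum_prod_type, bend,
    Matrix.of_apply, Matrix.map_apply]
  rw [Finset.sum_comm]
  refine Eq.trans ?_ this
  refine Finset.sum_congr rfl fun y _ => ?_
  rw [Finset.mul_sum]
  exact Finset.sum_congr rfl fun K _ => by rw [RCLike.star_def]; ring

/-- The relative normalization of dual Clebsch–Gordan tensors. -/
def dualScale (σ : IrrepBasis G) (l l' : UDual G) : ℝ := Real.sqrt (σ.d l' / σ.d l)

theorem dualScale_pos (σ : IrrepBasis G) (l l' : UDual G) : 0 < dualScale σ l l' :=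
  Real.sqrt_pos.2 (div_pos (Nat.cast_pos.2 (σ.d_pos _)) (Nat.cast_pos.2 (σ.d_pos _)))

theorem dualScale_mul_self (σ : IrrepBasis G) (l l' : UDual G) :
    (dualScale σ l l' : ℂ) * dualScale σ l l' * σ.d l = σ.d l' := by
  have h : (σ.d l : ℝ) ≠ 0 := by exact_mod_cast (σ.d_pos l).ne'
  have : dualScale σ l l' * dualScale σ l l' * σ.d l = σ.d l' := by
    rw [dualScale, Real.mul_self_sqrt (by positivity)]
    field_simp
  exact_mod_cast this

theorem dualScale_mul_dualScale (σ : IrrepBasis G) (l l' : UDual G) :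
    (dualScale σ l l' : ℂ) * dualScale σ l' l = 1 := by
  have h : (σ.d l : ℝ) ≠ 0 := by exact_mod_cast (σ.d_pos l).ne'
  have h' : (σ.d l' : ℝ) ≠ 0 := by exact_mod_cast (σ.d_pos l').ne'
  have : dualScale σ l l' * dualScale σ l' l = 1 := by
    rw [dualScale, dualScale, ← Real.sqrt_mul (by positivity)]
    rw [div_mul_div_cancel₀ h, div_self h', Real.sqrt_one]
  exact_mod_cast this

/-- The dual Clebsch–Gordan tensors. -/
def dualTensor {m : UDual G → UDual G → ℕ} (C : CGTensor σ ι m) :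
    CGTensor σ ι fun l l' => m l' l :=
  fun l l' i => (dualScale σ l l' : ℂ) • bend (C l' l i)

/-- Products of dual tensors are scalar by Schur, so their traces decide everything, and bending
preserves traces. The trace is `d_l` before bending and must be `d_l'` after it, which is the reason
for the scale `√(d_l' / d_l)`. -/
theorem IsUnitaryRep.isCG_dualTensor {ρ : G → Matrix ι ι ℂ} (hρ : IsUnitaryRep ρ)
    {m : UDual G → UDual G → ℕ} {C : CGTensor σ ι m} (hC : IsCG σ ρ m C) :
    IsCG σ (fun g => (ρ g).map star) (fun l l' => m l' l) (dualTensor C) := by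
  intro l
  have hτ := (σ.isUnitaryRep l).kronecker hρ.map_star
  have hint : ∀ l' (i : Fin (m l' l)) g, dualTensor C l l' i * (σ.mat l g ⊗ₖ (ρ g).map star)
      = σ.mat l' g * dualTensor C l l' i := fun l' i g => by
    rw [dualTensor, Matrix.smul_mul, Matrix.mul_smul, bend_intertwines ((hC l').intertwines l i)]
  have hint' : ∀ l' (i : Fin (m l' l)) g, (dualTensor C l l' i)ᴴ * σ.mat l' g
      = (σ.mat l g ⊗ₖ (ρ g).map star) * (dualTensor C l l' i)ᴴ := fun l' i g =>
    hτ.intertwines_conjTranspose (σ.isUnitaryRep l') (hint l' i) g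
  have htr : ∀ l' (i j : Fin (m l' l)), (dualTensor C l l' i * (dualTensor C l l' j)ᴴ).trace
      = (dualScale σ l l' : ℂ) * dualScale σ l l' * (C l' l j * (C l' l i)ᴴ).trace :=
    fun l' i j => by
      rw [dualTensor, dualTensor, Matrix.conjTranspose_smul, Matrix.smul_mul, Matrix.mul_smul,
        smul_smul, Matrix.trace_smul, trace_bend_mul, RCLike.star_def, Complex.conj_ofReal,
        smul_eq_mul]
  have hscalar : ∀ l' (i j : Fin (m l' l)), ∃ c : ℂ,
      dualTensor C l l' i * (dualTensor C l l' j)ᴴ = c • 1 ∧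
      c * σ.d l' = (dualScale σ l l' : ℂ) * dualScale σ l l' * (C l' l j * (C l' l i)ᴴ).trace :=
    fun l' i j => by
      obtain ⟨c, hc⟩ := σ.schur_scalar l' (dualTensor C l l' i * (dualTensor C l l' j)ᴴ) fun g => by
        rw [Matrix.mul_assoc, hint', ← Matrix.mul_assoc, hint, Matrix.mul_assoc]
      refine ⟨c, hc, ?_⟩
      rw [← htr, hc, Matrix.trace_smul, Matrix.trace_one, Fintype.card_fin, smul_eq_mul]
  have hd : ∀ l : UDual G, (σ.d l : ℂ) ≠ 0 := fun l => by exact_mod_cast (σ.d_pos l).ne'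
  refine hτ.isDecomposition_of_maximal hint (fun l' i => ?_) (fun l' i j hij => ?_) ?_
  · obtain ⟨c, hc, h⟩ := hscalar l' i i
    rw [(hC l').norm_block, Matrix.trace_one, Fintype.card_fin, dualScale_mul_self] at h
    rw [hc, mul_right_cancel₀ (hd l') (h.trans (one_mul _).symm), one_smul]
  · obtain ⟨c, hc, h⟩ := hscalar l' i j
    rw [(hC l').orth_mult _ _ _ hij.symm, Matrix.trace_zero, mul_zero] at h
    rw [hc, (mul_eq_zero.1 h).resolve_right (hd l'), zero_smul]
  · intro l' A hA hAD
    -- Completeness: an intertwiner orthogonal to all dual tensors bends back to one orthogonal in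
    -- trace to the tensors `C l' l i`. Completeness of `C l'`, with Schur for the other labels,
    -- makes it vanish.
    have hA' : ∀ g, bend A * (σ.mat l' g ⊗ₖ ρ g) = σ.mat l g * bend A := fun g => by
      have := bend_intertwines hA g
      have hcc : ((ρ g).map star).map star = ρ g := by
        ext i j
        simp
      rwa [hcc] at this
    have hzero : bend A = 0 := by
      obtain ⟨L, hL⟩ := exists_finset_isEmpty (hC l').finite
      rw [← Matrix.mul_one (bend A), ← (hC l').sum_eq_one hL, Matrix.mul_sum]
      refine Finset.sum_eq_zero fun l₁ _ => ?_
      rw [Matrix.mul_sum]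
      refine Finset.sum_eq_zero fun i _ => ?_
      have hX : ∀ g, bend A * (C l' l₁ i)ᴴ * σ.mat l₁ g = σ.mat l g * (bend A * (C l' l₁ i)ᴴ) :=
        fun g => by
          rw [Matrix.mul_assoc, ((σ.isUnitaryRep l').kronecker hρ).intertwines_conjTranspose
            (σ.isUnitaryRep l₁) ((hC l').intertwines l₁ i), ← Matrix.mul_assoc, hA',
            Matrix.mul_assoc]
      rw [← Matrix.mul_assoc]
      by_cases hl : l = l₁
      · subst hl
        obtain ⟨c, hc⟩ := σ.schur_scalar l _ hX
        have h1 : (bend A * (C l' l i)ᴴ).trace = 0 := by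
          have h2 := hAD i
          rw [dualTensor, Matrix.conjTranspose_smul, Matrix.mul_smul, smul_eq_zero] at h2
          have h3 := h2.resolve_left (by
            rw [RCLike.star_def, Complex.conj_ofReal]
            exact_mod_cast (dualScale_pos σ l l').ne')
          have h4 := trace_bend_mul (bend A) (C l' l i)
          rw [bend_bend, h3, Matrix.trace_zero] at h4
          have h5 := congrArg star h4
          rw [star_zero, ← Matrix.trace_conjTranspose, Matrix.conjTranspose_mul,
            Matrix.conjTranspose_conjTranspose] at h5
          exact h5.symm
        rw [hc, Matrix.trace_smul, Matrix.trace_one, Fintype.card_fin, smul_eq_mul] at h1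
        rw [hc, (mul_eq_zero.1 h1).resolve_right (hd l), zero_smul, Matrix.zero_mul]
      · rw [σ.schur_zero hl _ hX, Matrix.zero_mul]
    rw [← bend_bend A, hzero]
    ext M p
    simp [bend]

theorem isDualCG_dualTensor {R : G →* Matrix.unitaryGroup ι ℂ}
    (hR : Continuous fun g => (R g : Matrix ι ι ℂ)) {m : UDual G → UDual G → ℕ}
    {C : CGTensor σ ι m} (hC : IsCG σ (fun g => (R g : Matrix ι ι ℂ)) m C) :
    IsDualCG σ R C (dualTensor C) where
  isCG := (IsUnitaryRep.of_hom R hR).isCG_dualTensor hC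
  matched l l' _ := ⟨dualScale σ l l', dualScale_pos σ l l', fun _ _ _ => rfl⟩

/-- The matching condition leaves no freedom in the dual transform. -/
theorem IsDualCG.eq_dualTensor {R : G →* Matrix.unitaryGroup ι ℂ} {m : UDual G → UDual G → ℕ}
    {C : CGTensor σ ι m} (hC : IsCG σ (fun g => (R g : Matrix ι ι ℂ)) m C)
    {D : CGTensor σ ι fun l l' => m l' l} (hD : IsDualCG σ R C D) : D = dualTensor C := by
  funext l l' i
  obtain ⟨c, hc, h⟩ := hD.matched l l' i
  have hDc : D l l' i = (c : ℂ) • bend (C l' l i) := by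
    ext M' ⟨M, x⟩
    exact h M' M x
  -- The trace of the normalization condition fixes `c ^ 2 = d_l' / d_l`; positivity then fixes `c`.
  have htr := congrArg Matrix.trace ((hD.isCG l).norm_block l' i)
  rw [hDc, Matrix.conjTranspose_smul, Matrix.smul_mul, Matrix.mul_smul, smul_smul,
    Matrix.trace_smul, trace_bend_mul, (hC l').norm_block, Matrix.trace_one, Matrix.trace_one,
    Fintype.card_fin, Fintype.card_fin, RCLike.star_def, Complex.conj_ofReal, smul_eq_mul,
    ← dualScale_mul_self σ l l'] at htr
  have hd : (σ.d l : ℂ) ≠ 0 := by exact_mod_cast (σ.d_pos l).ne'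
  have h1 := mul_right_cancel₀ hd htr
  have h2 : c * c = dualScale σ l l' * dualScale σ l l' := by exact_mod_cast h1
  have h3 : c = dualScale σ l l' := (mul_self_inj hc.le (dualScale_pos σ l l').le).1 h2
  rw [hDc, h3, dualTensor]

end ClebschGordan

/-! ### Iterated decomposition along paths of irreps -/

section Paths

variable {G : Type u} [Group G] [TopologicalSpace G] {σ : IrrepBasis G}

theorem IsDecomposition.reindex {κ κ' : Type*} [Fintype κ] [DecidableEq κ] [Fintype κ']
    [DecidableEq κ'] {ρ : G → Matrix κ κ ℂ} {B : UDual G → Type w}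
    {W : (l : UDual G) → B l → Matrix (Fin (σ.d l)) κ ℂ} (h : IsDecomposition σ ρ B W)
    (e : κ' ≃ κ) :
    IsDecomposition σ (fun g => (ρ g).submatrix e e) B fun l T => (W l T).submatrix id e := by
  have hmul : ∀ l l' T S, (W l T).submatrix id e * ((W l' S).submatrix id e)ᴴ
      = W l T * (W l' S)ᴴ := fun l l' T S => by
    rw [Matrix.conjTranspose_submatrix, Matrix.submatrix_mul_equiv, Matrix.submatrix_id_id]
  refine ⟨h.finite, fun l T g => ?_, fun l T => ?_, fun l T S hTS => ?_, fun l l' T S hl => ?_, ?_⟩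
  · rw [Matrix.submatrix_mul_equiv, h.intertwines]
    rfl
  · rw [hmul, h.norm_block]
  · rw [hmul, h.orth_mult _ _ _ hTS]
  · rw [hmul, h.orth_irrep _ _ _ _ hl]
  · have := h.finite
    have := Fintype.ofFinite ((l : UDual G) × B l)
    have hc := h.complete
    rw [finsum_eq_sum_of_fintype] at hc ⊢
    have h2 := congrArg (fun Z : Matrix κ κ ℂ => Z.submatrix e e) hc
    simp only [Matrix.submatrix_one_equiv] at h2
    rw [← h2]
    ext i j
    simp [Matrix.sum_apply, Matrix.mul_apply]

/-- Decomposing a tensor product by decomposing one factor first. -/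
theorem IsDecomposition.comp {κ ι : Type*} [Fintype κ] [DecidableEq κ] [Fintype ι] [DecidableEq ι]
    {ρ : G → Matrix κ κ ℂ} {τ : G → Matrix ι ι ℂ} {B : UDual G → Type*}
    {W : (l : UDual G) → B l → Matrix (Fin (σ.d l)) κ ℂ} (h : IsDecomposition σ ρ B W)
    {B' : UDual G → UDual G → Type*}
    {C : (l l' : UDual G) → B' l l' → Matrix (Fin (σ.d l')) (Fin (σ.d l) × ι) ℂ}
    (hC : ∀ l, IsDecomposition σ (fun g => σ.mat l g ⊗ₖ τ g) (B' l) (C l)) :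
    IsDecomposition σ (fun g => ρ g ⊗ₖ τ g) (fun l' => (l : UDual G) × (B l × B' l l'))
      fun l' T => C T.1 l' T.2.2 * (W T.1 T.2.1 ⊗ₖ (1 : Matrix ι ι ℂ)) := by
  have hmul : ∀ (l₁ l₂ l l' : UDual G) (T : B l₁) (S : B l₂) (i : B' l₁ l) (j : B' l₂ l'),
      C l₁ l i * (W l₁ T ⊗ₖ (1 : Matrix ι ι ℂ)) * (C l₂ l' j * (W l₂ S ⊗ₖ (1 : Matrix ι ι ℂ)))ᴴ
      = C l₁ l i * ((W l₁ T * (W l₂ S)ᴴ) ⊗ₖ (1 : Matrix ι ι ℂ)) * (C l₂ l' j)ᴴ := by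
    intro l₁ l₂ l l' T S i j
    have := Matrix.mul_kronecker_mul (W l₁ T) ((W l₂ S)ᴴ) (1 : Matrix ι ι ℂ)
      (1 : Matrix ι ι ℂ)
    rw [Matrix.mul_one] at this
    rw [Matrix.conjTranspose_mul, Matrix.conjTranspose_kronecker, Matrix.conjTranspose_one, this]
    simp only [Matrix.mul_assoc]
  let e : ((p : (l : UDual G) × B l) × ((l' : UDual G) × B' p.1 l')) ≃
      ((l' : UDual G) × ((l : UDual G) × (B l × B' l l'))) :=
    { toFun := fun p => ⟨p.2.1, p.1.1, p.1.2, p.2.2⟩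
      invFun := fun p => ⟨⟨p.2.1, p.2.2.1⟩, p.1, p.2.2.2⟩
      left_inv := fun _ => rfl
      right_inv := fun _ => rfl }
  have hfin := h.finite
  have hfin' : ∀ l, Finite ((l' : UDual G) × B' l l') := fun l => (hC l).finite
  refine ⟨Finite.of_equiv _ e, ?_, ?_, ?_, ?_, ?_⟩
  · rintro l' ⟨l, T, i⟩ g
    have h1 := Matrix.mul_kronecker_mul (W l T) (ρ g) (1 : Matrix ι ι ℂ) (τ g)
    have h2 := Matrix.mul_kronecker_mul (σ.mat l g) (W l T) (τ g) (1 : Matrix ι ι ℂ)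
    rw [Matrix.one_mul] at h1
    rw [Matrix.mul_one] at h2
    change C l l' i * (W l T ⊗ₖ (1 : Matrix ι ι ℂ)) * (ρ g ⊗ₖ τ g)
      = σ.mat l' g * (C l l' i * (W l T ⊗ₖ (1 : Matrix ι ι ℂ)))
    rw [Matrix.mul_assoc, ← h1, h.intertwines, h2, ← Matrix.mul_assoc, (hC l).intertwines,
      Matrix.mul_assoc]
  · rintro l' ⟨l, T, i⟩
    rw [hmul, h.norm_block, Matrix.one_kronecker_one, Matrix.mul_one, (hC l).norm_block]
  · rintro l' ⟨l₁, T, i⟩ ⟨l₂, S, j⟩ hne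
    rw [hmul]
    by_cases hl : l₁ = l₂
    · subst hl
      by_cases hTS : T = S
      · subst hTS
        rw [h.norm_block, Matrix.one_kronecker_one, Matrix.mul_one, (hC l₁).orth_mult]
        rintro rfl
        exact hne rfl
      · rw [h.orth_mult _ _ _ hTS, Matrix.zero_kronecker, Matrix.mul_zero, Matrix.zero_mul]
    · rw [h.orth_irrep _ _ _ _ hl, Matrix.zero_kronecker, Matrix.mul_zero, Matrix.zero_mul]
  · rintro l l' ⟨l₁, T, i⟩ ⟨l₂, S, j⟩ hne
    rw [hmul]
    by_cases hl : l₁ = l₂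
    · subst hl
      by_cases hTS : T = S
      · subst hTS
        rw [h.norm_block, Matrix.one_kronecker_one, Matrix.mul_one, (hC l₁).orth_irrep _ _ _ _ hne]
      · rw [h.orth_mult _ _ _ hTS, Matrix.zero_kronecker, Matrix.mul_zero, Matrix.zero_mul]
    · rw [h.orth_irrep _ _ _ _ hl, Matrix.zero_kronecker, Matrix.mul_zero, Matrix.zero_mul]
  · rw [← finsum_comp_equiv e]
    have := Fintype.ofFinite ((l : UDual G) × B l)
    have (l : UDual G) : Fintype ((l' : UDual G) × B' l l') := Fintype.ofFinite _
    have hc := h.complete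
    rw [finsum_eq_sum_of_fintype] at hc ⊢
    rw [Fintype.sum_sigma]
    have hinner : ∀ p : (l : UDual G) × B l, ∑ r : (l' : UDual G) × B' p.1 l',
        (C p.1 r.1 r.2 * (W p.1 p.2 ⊗ₖ (1 : Matrix ι ι ℂ)))ᴴ *
          (C p.1 r.1 r.2 * (W p.1 p.2 ⊗ₖ (1 : Matrix ι ι ℂ)))
        = ((W p.1 p.2)ᴴ * W p.1 p.2) ⊗ₖ (1 : Matrix ι ι ℂ) := fun p => by
      have hc' := (hC p.1).complete
      rw [finsum_eq_sum_of_fintype] at hc'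
      have h1 := Matrix.mul_kronecker_mul ((W p.1 p.2)ᴴ) (W p.1 p.2) (1 : Matrix ι ι ℂ)
        (1 : Matrix ι ι ℂ)
      rw [Matrix.mul_one] at h1
      rw [h1]
      calc _ = ((W p.1 p.2)ᴴ ⊗ₖ (1 : Matrix ι ι ℂ)) *
            (∑ r : (l' : UDual G) × B' p.1 l', (C p.1 r.1 r.2)ᴴ * C p.1 r.1 r.2) *
            (W p.1 p.2 ⊗ₖ (1 : Matrix ι ι ℂ)) := by
            rw [Matrix.mul_sum, Matrix.sum_mul]
            refine Finset.sum_congr rfl fun r _ => ?_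
            rw [Matrix.conjTranspose_mul, Matrix.conjTranspose_kronecker, Matrix.conjTranspose_one]
            simp only [Matrix.mul_assoc]
        _ = _ := by rw [hc', Matrix.mul_one]
    refine (Finset.sum_congr rfl fun p _ => hinner p).trans ?_
    rw [← Matrix.one_kronecker_one, ← hc]
    ext i j
    simp only [Matrix.sum_apply, Matrix.kroneckerMap_apply, Finset.sum_mul]

/-- The chosen representative is only equivalent to the trivial one, but conjugating the identity
gives the identity, and traces of `U * Uᴴ` and `Uᴴ * U` compare the dimensions. -/
theorem IrrepBasis.triv_spec (σ : IrrepBasis G) :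
    σ.d (triv G) = 1 ∧ ∀ g, σ.mat (triv G) g = 1 := by
  obtain ⟨U, h1, h2, h3⟩ : ∃ U : Matrix (Fin (σ.d (triv G))) (Fin 1) ℂ, Uᴴ * U = 1 ∧ U * Uᴴ = 1 ∧
      ∀ g : G, U * ((1 : G →* Matrix.unitaryGroup (Fin 1) ℂ) g : Matrix (Fin 1) (Fin 1) ℂ)
        = σ.mat (triv G) g * U :=
    Quotient.exact (σ.mk_irrep (triv G))
  constructor
  · have h4 := Matrix.trace_mul_comm U Uᴴ
    rw [h1, h2, Matrix.trace_one, Matrix.trace_one, Fintype.card_fin, Fintype.card_fin] at h4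
    exact_mod_cast h4
  · intro g
    have h5 := congrArg (fun Z => Z * Uᴴ) (h3 g)
    simp only [MonoidHom.one_apply, OneMemClass.coe_one, Matrix.mul_one] at h5
    rw [Matrix.mul_assoc, h2, Matrix.mul_one] at h5
    exact h5.symm

variable {ι : Type v} [Fintype ι] [DecidableEq ι] {R : G →* Matrix.unitaryGroup ι ℂ}
  {m : UDual G → UDual G → ℕ} {C : CGTensor σ ι m} {D : CGTensor σ ι fun l l' => m l' l}

theorem isCG_stepTensor (hC : IsCG σ (fun g => (R g : Matrix ι ι ℂ)) m C)
    (hD : IsCG σ (conjRep R) (fun l l' => m l' l) D) (q : Query) :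
    IsCG σ (q.base R) (stepMult m q) (stepTensor C D q) := by
  cases q
  exacts [hC, hD, hC, hD]

/-- Splitting off the last coordinate. -/
def initLast (n : ℕ) (ι : Type v) : (Fin (n + 1) → ι) ≃ (Fin n → ι) × ι where
  toFun x := (Fin.init x, x (Fin.last n))
  invFun p := Fin.snoc p.1 p.2
  left_inv x := Fin.snoc_init_self x
  right_inv p := by simp

theorem isDecomposition_pathTensor (hC : IsCG σ (fun g => (R g : Matrix ι ι ℂ)) m C)
    (hD : IsCG σ (conjRep R) (fun l l' => m l' l) D) :
    ∀ (n : ℕ) (q : Fin n → Query),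
      IsDecomposition σ (tensorRep R q) (IrrepPath m n q) (pathTensor C D n q)
  -- The empty tensor product and the trivial irrep are both one-dimensional, and the empty path is
  -- the only one, so its constant entry `1` is a unitary block.
  | 0, q => by
    obtain ⟨hd, hmat⟩ := σ.triv_spec
    have hsub : Subsingleton (Fin (σ.d (triv G))) := by rw [hd]; infer_instance
    have hB : ∀ {l}, IrrepPath m 0 q l → l = triv G := fun T => T.down.down
    have hone : tensorRep R q = fun _ => 1 := by
      funext g
      ext a b
      rw [Subsingleton.elim a b, Matrix.one_apply_eq]
      simp [tensorRep]
    have hnorm : ∀ l T, pathTensor C D 0 q l T * (pathTensor C D 0 q l T)ᴴ = 1 := fun l T => by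
      obtain rfl := hB T
      ext M N
      rw [Subsingleton.elim M N, Matrix.mul_apply, Matrix.one_apply_eq]
      simp [pathTensor]
    have hsubB : ∀ l, Subsingleton (IrrepPath m 0 q l) := fun l => by
      unfold IrrepPath
      infer_instance
    have huniq : ∀ p p' : (l : UDual G) × IrrepPath m 0 q l, p = p' := by
      rintro ⟨l, T⟩ ⟨l', T'⟩
      obtain rfl := hB T
      obtain rfl := hB T'
      rw [Subsingleton.elim T T']
    let p₀ : (l : UDual G) × IrrepPath m 0 q l := ⟨triv G, ⟨⟨rfl⟩⟩⟩
    have hS : Subsingleton ((l : UDual G) × IrrepPath m 0 q l) := ⟨huniq⟩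
    refine ⟨Finite.of_subsingleton, fun l T g => ?_, hnorm, fun l T S hTS => ?_,
      fun l l' T S hl => ?_, ?_⟩
    · obtain rfl := hB T
      rw [hone, hmat, Matrix.mul_one, Matrix.one_mul]
    · exact absurd (Subsingleton.elim T S) hTS
    · exact absurd ((hB T).trans (hB S).symm) hl
    · rw [finsum_eq_single _ p₀ fun p hp => absurd (huniq p p₀) hp]
      ext a b
      rw [Subsingleton.elim a b, Matrix.one_apply_eq, Matrix.mul_apply,
        Fintype.sum_subsingleton _ (⟨0, σ.d_pos _⟩ : Fin (σ.d (triv G)))]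
      simp [pathTensor]
  | n + 1, q => by
    -- The first `n` factors are decomposed, each resulting irrep is tensored with the last factor
    -- and decomposed again, and the last coordinate is merged back into the tuple.
    have h := ((isDecomposition_pathTensor hC hD n (Fin.init q)).comp
      (isCG_stepTensor hC hD (q (Fin.last n)))).reindex (initLast n ι)
    have h1 : (fun g => (tensorRep R (Fin.init q) g ⊗ₖ (q (Fin.last n)).base R g).submatrix
        (initLast n ι) (initLast n ι)) = tensorRep R q := by
      funext g
      ext a b
      simp [tensorRep, initLast, Fin.prod_univ_castSucc, Fin.init]
    have h2 : (fun (l' : UDual G) (T : (l : UDual G) × (IrrepPath m n (Fin.init q) l ×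
        Fin (stepMult m (q (Fin.last n)) l l'))) =>
        (stepTensor C D (q (Fin.last n)) T.1 l' T.2.2 *
          (pathTensor C D n (Fin.init q) T.1 T.2.1 ⊗ₖ (1 : Matrix ι ι ℂ))).submatrix id
            (initLast n ι)) = pathTensor C D (n + 1) q := by
      funext l' T
      ext M' x
      simp [pathTensor, initLast, Matrix.mul_apply, Fintype.sum_prod_type, Matrix.one_apply]
    rw [h1, h2] at h
    exact h

end Paths

/-! ### Unitary operators from infinite matrices -/

section UnitaryKernels

/-- `K` is an infinite matrix with finitely supported orthonormal columns; `K j i` is the entry in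
row `j` and column `i`. -/
def HasOrthonormalColumns {J : Type*} (K : J → J → ℂ) : Prop :=
  ∃ s : J → Finset J, (∀ i, ∀ j ∉ s i, K j i = 0) ∧
    (∀ i, ∑ j ∈ s i, conj (K j i) * K j i = 1) ∧
    ∀ i i', i ≠ i' → ∑ j ∈ s i, conj (K j i) * K j i' = 0

theorem HasOrthonormalColumns.comp_equiv {J : Type*} {K : J → J → ℂ}
    (h : HasOrthonormalColumns K) (e : J ≃ J) :
    HasOrthonormalColumns fun j i => K (e j) (e i) := by
  obtain ⟨s, h0, h1, h2⟩ := h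
  refine ⟨fun i => (s (e i)).map e.symm.toEmbedding, fun i j hj => h0 _ _ fun hm => hj ?_,
    fun i => ?_, fun i i' hne => ?_⟩
  · exact Finset.mem_map.2 ⟨e j, hm, e.symm_apply_apply j⟩
  · simpa using h1 (e i)
  · simpa using h2 (e i) (e i') fun hm => hne (e.injective hm)

theorem HasOrthonormalColumns.conj {J : Type*} {K : J → J → ℂ} (h : HasOrthonormalColumns K) :
    HasOrthonormalColumns fun j i => conj (K j i) := by
  obtain ⟨s, h0, h1, h2⟩ := h
  refine ⟨s, fun i j hj => by simp only [h0 i j hj, map_zero], fun i => ?_, fun i i' hne => ?_⟩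
  · have := congrArg (starRingEnd ℂ) (h1 i)
    simpa only [map_sum, map_mul, map_one] using this
  · have := congrArg (starRingEnd ℂ) (h2 i i' hne)
    simpa only [map_sum, map_mul, map_zero] using this

theorem hilbertBasis_ext {J H : Type*} [NormedAddCommGroup H] [InnerProductSpace ℂ H]
    (e : HilbertBasis J ℂ H) {f g : H} (h : ∀ j, ⟪e j, f⟫_ℂ = ⟪e j, g⟫_ℂ) : f = g := by
  apply e.repr.injective
  ext j
  rw [e.repr_apply_apply, e.repr_apply_apply, h]

/-- A matrix with finitely supported orthonormal rows and columns defines a unitary operator. -/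
theorem exists_unitary_of_matrix {J H : Type*} [NormedAddCommGroup H] [InnerProductSpace ℂ H]
    [CompleteSpace H] (e : HilbertBasis J ℂ H) {K : J → J → ℂ} (hcol : HasOrthonormalColumns K)
    (hrow : HasOrthonormalColumns fun i j => K j i) :
    ∃ U : unitary (H →L[ℂ] H), ∀ i j, ⟪e j, (U : H →L[ℂ] H) (e i)⟫_ℂ = K j i := by
  classical
  obtain ⟨s, hs0, hs1, hs2⟩ := hcol
  obtain ⟨t, ht0, ht1, ht2⟩ := hrow
  let v : J → H := fun i => ∑ j ∈ s i, K j i • e j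
  have hev : ∀ i j, ⟪e j, v i⟫_ℂ = K j i := fun i j => by
    simp only [v, inner_sum, inner_smul_right, orthonormal_iff_ite.1 e.orthonormal, mul_ite,
      mul_one, mul_zero, Finset.sum_ite_eq]
    split_ifs with h
    · rfl
    · exact (hs0 i j h).symm
  have hv : Orthonormal ℂ v := by
    rw [orthonormal_iff_ite]
    intro i i'
    have h1 : ⟪v i, v i'⟫_ℂ = ∑ j ∈ s i, conj (K j i) * K j i' := by
      conv_lhs => rw [show v i = ∑ j ∈ s i, K j i • e j from rfl]
      rw [sum_inner]
      exact Finset.sum_congr rfl fun j _ => by rw [inner_smul_left, hev]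
    rw [h1]
    split_ifs with h
    · subst h
      exact hs1 i
    · exact hs2 i i' h
  -- Orthonormality of the rows writes each `e j` as a finite combination of the columns `v i`, so
  -- these are a Hilbert basis and the operator is the change of basis `e i ↦ v i`.
  have hspan : ⊤ ≤ (Submodule.span ℂ (Set.range v)).topologicalClosure := by
    rw [← e.dense_span]
    refine Submodule.topologicalClosure_mono (Submodule.span_le.2 ?_)
    rintro _ ⟨j, rfl⟩
    have : e j = ∑ i ∈ t j, conj (K j i) • v i := by
      refine hilbertBasis_ext e fun j' => ?_
      rw [inner_sum, orthonormal_iff_ite.1 e.orthonormal]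
      simp only [inner_smul_right, hev]
      by_cases h : j = j'
      · subst h
        rw [if_pos rfl, ht1]
      · rw [if_neg (Ne.symm h), ht2 _ _ h]
    rw [this]
    exact Submodule.sum_mem _ fun i _ => Submodule.smul_mem _ _ (Submodule.subset_span ⟨i, rfl⟩)
  let b := HilbertBasis.mk hv hspan
  refine ⟨Unitary.linearIsometryEquiv.symm (e.repr.trans b.repr.symm), fun i j => ?_⟩
  have : b i = v i := congrFun (HilbertBasis.coe_mk hv hspan) i
  rw [← hev, ← this]
  congr 1
  change b.repr.symm (e.repr (e i)) = b i
  rw [e.repr_self, b.repr_symm_single]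

theorem unitary_ext {J H : Type*} [NormedAddCommGroup H] [InnerProductSpace ℂ H]
    [CompleteSpace H] (e : HilbertBasis J ℂ H) {U V : unitary (H →L[ℂ] H)}
    (h : ∀ i j, ⟪e j, (U : H →L[ℂ] H) (e i)⟫_ℂ = ⟪e j, (V : H →L[ℂ] H) (e i)⟫_ℂ) : U = V := by
  apply Subtype.ext
  refine ContinuousLinearMap.ext_on (s := Set.range e) ?_ ?_
  · exact Submodule.dense_iff_topologicalClosure_eq_top.2 e.dense_span
  · rintro _ ⟨i, rfl⟩
    exact hilbertBasis_ext e (h i)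

end UnitaryKernels

/-! ### Unitarity of the compressed oracles -/

section Oracles

variable {G : Type u} [Group G] [TopologicalSpace G] {ι : Type v} [Fintype ι] [DecidableEq ι]
  {σ : IrrepBasis G}

theorem ket_eq_single [DecidableEq (MemIdx σ)] (a : MemIdx σ) :
    ket a = lp.single (E := fun _ : MemIdx σ => ℂ) 2 a (1 : ℂ) := by
  rw [ket]
  congr!

theorem ket_apply (a b : MemIdx σ) [Decidable (b = a)] : ket a b = if b = a then 1 else 0 := by
  classical
  rw [ket_eq_single, lp.single_apply, Pi.single_apply]
  congr!

theorem inner_ket (a : MemIdx σ) (f : Mem σ) : ⟪ket a, f⟫_ℂ = f a := by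
  classical
  rw [ket_eq_single, lp.inner_single_left (𝕜 := ℂ) (G := fun _ : MemIdx σ => ℂ)]
  simp

/-- The basis vector `|l, M, M̄⟩|x⟩`. -/
def jointKet (σ : IrrepBasis G) (ι : Type v) [Fintype ι] (p : MemIdx σ × ι) : Joint σ ι :=
  ContinuousLinearMap.adjoint (bra σ p.2) (ket p.1)

omit [DecidableEq ι] in
theorem inner_jointKet (p : MemIdx σ × ι) (f : Joint σ ι) :
    ⟪jointKet σ ι p, f⟫_ℂ = f p.2 p.1 := by
  rw [jointKet, ContinuousLinearMap.adjoint_inner_left, inner_ket]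
  rfl

theorem jointKet_apply (p r : MemIdx σ × ι) [Decidable (r = p)] :
    jointKet σ ι p r.2 r.1 = if r = p then 1 else 0 := by
  classical
  have h : jointKet σ ι p = WithLp.toLp 2 (Pi.single p.2 (ket p.1)) := by
    refine ext_inner_right ℂ fun f => ?_
    rw [jointKet, ContinuousLinearMap.adjoint_inner_left, PiLp.inner_apply,
      Finset.sum_eq_single p.2]
    · simp [bra]
    · intro y _ hy
      simp [Pi.single_eq_of_ne hy]
    · simp
  rw [h]
  obtain ⟨a, x⟩ := p
  obtain ⟨b, y⟩ := r
  change (Pi.single x (ket a) : ι → Mem σ) y b = _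
  by_cases hxy : y = x
  · subst hxy
    rw [Pi.single_eq_same, ket_apply]
    simp
  · rw [Pi.single_eq_of_ne hxy, if_neg fun h => hxy (Prod.ext_iff.1 h).2]
    rfl

/-- The Hilbert basis of the joint space. -/
def jointBasis (σ : IrrepBasis G) (ι : Type v) [Fintype ι] [DecidableEq ι] :
    HilbertBasis (MemIdx σ × ι) ℂ (Joint σ ι) :=
  HilbertBasis.mkOfOrthogonalEqBot (v := jointKet σ ι)
    (by
      classical
      rw [orthonormal_iff_ite]
      intro p r
      rw [inner_jointKet, jointKet_apply])
    (by
      rw [Submodule.eq_bot_iff]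
      intro f hf
      rw [Submodule.mem_orthogonal] at hf
      ext x a
      have := hf (jointKet σ ι (a, x)) (Submodule.subset_span ⟨_, rfl⟩)
      rwa [inner_jointKet] at this)

theorem jointBasis_apply (p : MemIdx σ × ι) : jointBasis σ ι p = jointKet σ ι p :=
  congrFun (HilbertBasis.coe_mkOfOrthogonalEqBot _ _) p

theorem inner_ket_block (X : Joint σ ι →L[ℂ] Joint σ ι) (a b : MemIdx σ) (x y : ι) :
    ⟪ket b, block X y x (ket a)⟫_ℂ = ⟪jointBasis σ ι (b, y), X (jointBasis σ ι (a, x))⟫_ℂ := by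
  rw [jointBasis_apply, jointBasis_apply, jointKet, ContinuousLinearMap.adjoint_inner_left]
  rfl

variable {m : UDual G → UDual G → ℕ}

/-- Exchange of the registers of `V_l` and its conjugate. -/
def swapMem (σ : IrrepBasis G) (ι : Type v) : MemIdx σ × ι ≃ MemIdx σ × ι :=
  (Equiv.sigmaCongrRight fun _ => Equiv.prodComm _ _).prodCongr (Equiv.refl ι)

/-- A Clebsch–Gordan transform followed by an inverse one is an isometry. -/
theorem hasOrthonormalColumns_kernel {ρ τ : G → Matrix ι ι ℂ} {X : CGTensor σ ι m}
    {Y : CGTensor σ ι fun l l' => m l' l} (hX : IsCG σ ρ m X)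
    (hY : IsCG σ τ (fun l l' => m l' l) Y) :
    HasOrthonormalColumns fun j i : MemIdx σ × ι => kernel X Y .forward i.1 i.2 j.1 j.2 := by
  choose L hL using fun l => exists_finset_isEmpty (hX l).finite
  -- The inner product of two columns. Summing over the outputs `N'`, `y` of the second gate
  -- produces `Y * Yᴴ`, so orthogonality of `Y` matches `l`, `i` and `N`, after which completeness
  -- of `X` matches `M` and `x`.
  have key : ∀ (l : UDual G) (M N : Fin (σ.d l)) (x : ι) (l₁ : UDual G) (M₁ N₁ : Fin (σ.d l₁))
      (x₁ : ι), ∑ j ∈ ((L l).sigma fun _ => Finset.univ) ×ˢ (Finset.univ : Finset ι),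
        conj (kernel X Y .forward ⟨l, M, N⟩ x j.1 j.2) * kernel X Y .forward ⟨l₁, M₁, N₁⟩ x₁ j.1 j.2
      = ∑ l' ∈ L l, ∑ M' : Fin (σ.d l'), ∑ i : Fin (m l l'), ∑ j : Fin (m l₁ l'),
        conj (X l l' i M' (M, x)) * X l₁ l' j M' (M₁, x₁) *
          (Y l' l₁ j * (Y l' l i)ᴴ) N₁ N := by
    intro l M N x l₁ M₁ N₁ x₁
    rw [Finset.sum_product, Finset.sum_sigma]
    refine Finset.sum_congr rfl fun l' _ => ?_
    rw [Fintype.sum_prod_type]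
    refine Finset.sum_congr rfl fun M' _ => ?_
    have hswap : ∀ (F : Fin (σ.d l') → ι → Fin (m l l') → Fin (m l₁ l') → ℂ),
        ∑ N', ∑ y, ∑ i, ∑ j, F N' y i j = ∑ i, ∑ j, ∑ N', ∑ y, F N' y i j := fun F => by
      calc ∑ N', ∑ y, ∑ i, ∑ j, F N' y i j = ∑ N', ∑ i, ∑ y, ∑ j, F N' y i j :=
            Finset.sum_congr rfl fun _ _ => Finset.sum_comm
        _ = ∑ i, ∑ N', ∑ y, ∑ j, F N' y i j := Finset.sum_comm
        _ = ∑ i, ∑ N', ∑ j, ∑ y, F N' y i j :=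
            Finset.sum_congr rfl fun _ _ => Finset.sum_congr rfl fun _ _ => Finset.sum_comm
        _ = _ := Finset.sum_congr rfl fun _ _ => Finset.sum_comm
    have hterm : ∀ (N' : Fin (σ.d l')) (y : ι),
        conj (kernel X Y .forward ⟨l, M, N⟩ x ⟨l', M', N'⟩ y) *
          kernel X Y .forward ⟨l₁, M₁, N₁⟩ x₁ ⟨l', M', N'⟩ y =
        ∑ i : Fin (m l l'), ∑ j : Fin (m l₁ l'), conj (X l l' i M' (M, x)) * X l₁ l' j M' (M₁, x₁) *
          (Y l' l₁ j N₁ (N', y) * conj (Y l' l i N (N', y))) := fun N' y => by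
      rw [kernel, kernel, map_sum, Finset.sum_mul_sum]
      refine Finset.sum_congr rfl fun i _ => Finset.sum_congr rfl fun j _ => ?_
      rw [map_mul]
      ring
    simp only [hterm]
    rw [hswap fun N' y i j => conj (X l l' i M' (M, x)) * X l₁ l' j M' (M₁, x₁) *
          (Y l' l₁ j N₁ (N', y) * conj (Y l' l i N (N', y)))]
    refine Finset.sum_congr rfl fun i _ => Finset.sum_congr rfl fun j _ => ?_
    rw [Matrix.mul_apply, Fintype.sum_prod_type, Finset.mul_sum]
    refine Finset.sum_congr rfl fun N' _ => ?_
    rw [Finset.mul_sum]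
    rfl
  have hsame : ∀ (l : UDual G) (M N : Fin (σ.d l)) (x : ι) (M₁ N₁ : Fin (σ.d l)) (x₁ : ι),
      ∑ l' ∈ L l, ∑ M' : Fin (σ.d l'), ∑ i : Fin (m l l'), ∑ j : Fin (m l l'),
        conj (X l l' i M' (M, x)) * X l l' j M' (M₁, x₁) * (Y l' l j * (Y l' l i)ᴴ) N₁ N
      = (1 : Matrix (Fin (σ.d l) × ι) (Fin (σ.d l) × ι) ℂ) (M, x) (M₁, x₁) *
        (1 : Matrix (Fin (σ.d l)) (Fin (σ.d l)) ℂ) N₁ N := by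
    intro l M N x M₁ N₁ x₁
    rw [← (hX l).sum_eq_one (hL l)]
    simp only [Matrix.sum_apply, Finset.sum_mul]
    refine Finset.sum_congr rfl fun l' _ => ?_
    rw [Finset.sum_comm]
    refine Finset.sum_congr rfl fun i _ => ?_
    rw [Matrix.mul_apply, Finset.sum_mul]
    refine Finset.sum_congr rfl fun M' _ => ?_
    rw [Finset.sum_eq_single i]
    · rw [(hY l').norm_block]
      rfl
    · intro j _ hj
      rw [(hY l').orth_mult _ _ _ hj, Matrix.zero_apply, mul_zero]
    · simp
  refine ⟨fun i => ((L i.1.1).sigma fun _ => Finset.univ) ×ˢ Finset.univ, ?_, ?_, ?_⟩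
  · rintro ⟨⟨l, M, N⟩, x⟩ ⟨⟨l', M', N'⟩, y⟩ hj
    have : IsEmpty (Fin (m l l')) := hL l l' fun h => hj (by simpa using h)
    simp [kernel]
  · rintro ⟨⟨l, M, N⟩, x⟩
    rw [key, hsame, Matrix.one_apply_eq, Matrix.one_apply_eq, mul_one]
  · rintro ⟨⟨l, M, N⟩, x⟩ ⟨⟨l₁, M₁, N₁⟩, x₁⟩ hne
    rw [key]
    by_cases hl : l = l₁
    · subst hl
      rw [hsame]
      by_cases hN : N₁ = N
      · subst hN
        rw [Matrix.one_apply_ne, zero_mul]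
        intro h
        simp only [Prod.mk.injEq] at h
        exact hne (by rw [h.1, h.2])
      · rw [Matrix.one_apply_ne hN, mul_zero]
    · refine Finset.sum_eq_zero fun l' _ => Finset.sum_eq_zero fun M' _ =>
        Finset.sum_eq_zero fun i _ => Finset.sum_eq_zero fun j _ => ?_
      rw [(hY l').orth_irrep _ _ _ _ (Ne.symm hl), Matrix.zero_apply, mul_zero]

variable {C : CGTensor σ ι m} {D : CGTensor σ ι fun l l' => m l' l}

/-- The compressed oracles of the four types are uniquely determined unitary operators. -/
theorem existsUnique_oracle {ρ τ : G → Matrix ι ι ℂ} (hC : IsCG σ ρ m C)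
    (hD : IsCG σ τ (fun l l' => m l' l) D) :
    ∃! O : Query → unitary (Joint σ ι →L[ℂ] Joint σ ι), ∀ q, IsOracle C D q (O q) := by
  have hCD := hasOrthonormalColumns_kernel hC hD
  have hDC := hasOrthonormalColumns_kernel hD hC
  have key : ∀ q, HasOrthonormalColumns (fun j i : MemIdx σ × ι => kernel C D q i.1 i.2 j.1 j.2) ∧
      HasOrthonormalColumns (fun i j : MemIdx σ × ι => kernel C D q i.1 i.2 j.1 j.2) := by
    -- Reversing a forward oracle exchanges `C` with `D` and `M` with `M̄`, so orthonormal rows for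
    -- one order of the transforms are orthonormal columns for the other.
    have h1 : (fun j i : MemIdx σ × ι => kernel C D .forward j.1 j.2 i.1 i.2) = fun j i =>
        kernel D C .forward (swapMem σ ι i).1 (swapMem σ ι i).2 (swapMem σ ι j).1
          (swapMem σ ι j).2 := by
      funext ⟨⟨l', M', N'⟩, y⟩ ⟨⟨l, M, N⟩, x⟩
      exact Finset.sum_congr rfl fun i _ => mul_comm _ _
    have h2 : (fun j i : MemIdx σ × ι => kernel D C .forward j.1 j.2 i.1 i.2) = fun j i =>
        kernel C D .forward (swapMem σ ι i).1 (swapMem σ ι i).2 (swapMem σ ι j).1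
          (swapMem σ ι j).2 := by
      funext ⟨⟨l', M', N'⟩, y⟩ ⟨⟨l, M, N⟩, x⟩
      exact Finset.sum_congr rfl fun i _ => mul_comm _ _
    have hCD' : HasOrthonormalColumns
        (fun i j : MemIdx σ × ι => kernel C D .forward i.1 i.2 j.1 j.2) := by
      rw [h1]
      exact hDC.comp_equiv (swapMem σ ι)
    have hDC' : HasOrthonormalColumns
        (fun i j : MemIdx σ × ι => kernel D C .forward i.1 i.2 j.1 j.2) := by
      rw [h2]
      exact hCD.comp_equiv (swapMem σ ι)
    -- The two remaining types are complex conjugates of the previous kernels with the memory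
    -- registers exchanged, and both operations preserve orthonormality.
    have h3 : ∀ i j : MemIdx σ × ι, kernel C D .transpose i.1 i.2 j.1 j.2 =
        conj (kernel C D .forward (swapMem σ ι i).1 (swapMem σ ι i).2 (swapMem σ ι j).1
          (swapMem σ ι j).2) := by
      rintro ⟨⟨l, M, N⟩, x⟩ ⟨⟨l', M', N'⟩, y⟩
      simp only [kernel, ← map_mul, ← map_sum]
      rfl
    have h4 : ∀ i j : MemIdx σ × ι, kernel C D .inverse i.1 i.2 j.1 j.2 =
        conj (kernel D C .forward (swapMem σ ι i).1 (swapMem σ ι i).2 (swapMem σ ι j).1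
          (swapMem σ ι j).2) := by
      rintro ⟨⟨l, M, N⟩, x⟩ ⟨⟨l', M', N'⟩, y⟩
      simp only [kernel, ← map_mul, ← map_sum]
      rfl
    intro q
    cases q with
    | forward => exact ⟨hCD, hCD'⟩
    | conjugate => exact ⟨hDC, hDC'⟩
    | transpose =>
      simp only [h3]
      exact ⟨(hCD.comp_equiv (swapMem σ ι)).conj, (hCD'.comp_equiv (swapMem σ ι)).conj⟩
    | inverse =>
      simp only [h4]
      exact ⟨(hDC.comp_equiv (swapMem σ ι)).conj, (hDC'.comp_equiv (swapMem σ ι)).conj⟩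
  choose O hO using fun q => exists_unitary_of_matrix (jointBasis σ ι) (key q).1 (key q).2
  refine ⟨O, fun q a x b y => ?_, fun O' hO' => ?_⟩
  · rw [inner_ket_block, hO]
  · funext q
    refine unitary_ext (jointBasis σ ι) ?_
    rintro ⟨a, x⟩ ⟨b, y⟩
    rw [hO, ← inner_ket_block, hO' q a x b y]

end Oracles

/-! ### The memory state after a sequence of queries and its trace -/

section Memory

variable {G : Type u} [Group G] [TopologicalSpace G] {ι : Type v} [Fintype ι] [DecidableEq ι]
  {σ : IrrepBasis G}

theorem hasSum_memIdx {E : Type*} [AddCommMonoid E] [TopologicalSpace E] {L : Finset (UDual G)}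
    {f : MemIdx σ → E} (hf : ∀ l ∉ L, ∀ M N, f ⟨l, M, N⟩ = 0) :
    HasSum f (∑ l ∈ L, ∑ M, ∑ N, f ⟨l, M, N⟩) := by
  have h : ∑ l ∈ L, ∑ M, ∑ N, f ⟨l, M, N⟩ = ∑ p ∈ L.sigma fun _ => Finset.univ, f p := by
    rw [Finset.sum_sigma]
    exact Finset.sum_congr rfl fun l _ => (Fintype.sum_prod_type fun r => f ⟨l, r⟩).symm
  rw [h]
  refine hasSum_sum_of_ne_finset_zero ?_
  rintro ⟨l, M, N⟩ hp
  exact hf l (fun h => hp (by simpa using h)) M N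

/-- Expansion of a matrix element on a vector supported on finitely many irreps. -/
theorem apply_eq_sum (A : Mem σ →L[ℂ] Mem σ) {L : Finset (UDual G)} {f : Mem σ}
    (hf : ∀ l ∉ L, ∀ M N, f ⟨l, M, N⟩ = 0) (b : MemIdx σ) :
    A f b = ∑ l ∈ L, ∑ M, ∑ N, f ⟨l, M, N⟩ * ⟪ket b, A (ket ⟨l, M, N⟩)⟫_ℂ := by
  classical
  have h1 : HasSum (fun a : MemIdx σ => f a • ket a) f := by
    have := lp.hasSum_single (E := fun _ : MemIdx σ => ℂ) (p := 2) ENNReal.ofNat_ne_top f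
    refine this.congr_fun fun a => ?_
    rw [ket_eq_single, ← lp.single_smul, smul_eq_mul, mul_one]
  have h2 := h1.unique (hasSum_memIdx fun l hl M N => by rw [hf l hl, zero_smul])
  have h3 := congrArg A h2
  rw [← inner_ket, h3]
  simp only [map_sum, map_smul, inner_sum, inner_smul_right]

omit [DecidableEq ι] in
/-- The adjoint of a block is a block of the adjoint. -/
theorem block_star (U : unitary (Joint σ ι →L[ℂ] Joint σ ι)) (x y : ι) :
    block (star U : Joint σ ι →L[ℂ] Joint σ ι) x y
      = star (block (U : Joint σ ι →L[ℂ] Joint σ ι) y x) := by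
  rw [ContinuousLinearMap.star_eq_adjoint, ContinuousLinearMap.star_eq_adjoint, block, block,
    ContinuousLinearMap.adjoint_comp, ContinuousLinearMap.adjoint_comp, ContinuousLinearMap.adjoint_adjoint,
    ContinuousLinearMap.comp_assoc]

theorem prod_ofFn_star {A : Type*} [Monoid A] [StarMul A] :
    ∀ {n : ℕ} (f : Fin n → A),
      (List.ofFn fun k => star (f k)).prod = star (List.ofFn f).reverse.prod
  | 0, f => by simp
  | n + 1, f => by
    rw [List.ofFn_succ, List.ofFn_succ, List.prod_cons, prod_ofFn_star, List.reverse_cons,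
      List.prod_append, star_mul]
    simp

/-- The memory state after a sequence of queries with given inputs and outputs. -/
def memState (O : Query → unitary (Joint σ ι →L[ℂ] Joint σ ι)) {n : ℕ} (q : Fin n → Query)
    (x y : Fin n → ι) : Mem σ :=
  (List.ofFn fun k => block (O (q k) : Joint σ ι →L[ℂ] Joint σ ι) (y k) (x k)).reverse.prod
    (vacuum σ)

omit [DecidableEq ι] in
theorem memState_succ (O : Query → unitary (Joint σ ι →L[ℂ] Joint σ ι)) {n : ℕ}
    (q : Fin (n + 1) → Query) (x y : Fin (n + 1) → ι) :
    memState O q x y = block (O (q (Fin.last n)) : Joint σ ι →L[ℂ] Joint σ ι) (y (Fin.last n))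
      (x (Fin.last n)) (memState O (Fin.init q) (Fin.init x) (Fin.init y)) := by
  rw [memState, List.ofFn_succ', List.concat_eq_append, List.reverse_append, List.reverse_singleton,
    List.singleton_append, List.prod_cons]
  rfl

omit [DecidableEq ι] in
-- The right-hand product of blocks is the adjoint of a left-hand one, so the operator has rank at
-- most one, `|ψ⟩⟨ψ'|`. Its trace is `⟨ψ', ψ⟩`, a finite sum when `ψ` lives on finitely many irreps.
theorem hasTrace_memoryOp (O : Query → unitary (Joint σ ι →L[ℂ] Joint σ ι)) {n : ℕ}
    (q : Fin n → Query) (x y x' y' : Fin n → ι) {L : Finset (UDual G)}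
    (hL : ∀ l ∉ L, ∀ M N, memState O q x y ⟨l, M, N⟩ = 0) :
    HasTrace (memoryOp O q x y x' y') (∑ l ∈ L, ∑ M, ∑ N,
      memState O q x y ⟨l, M, N⟩ * conj (memState O q x' y' ⟨l, M, N⟩)) := by
  have h : ∀ a : MemIdx σ, ⟪ket a, memoryOp O q x y x' y' (ket a)⟫_ℂ
      = memState O q x y a * conj (memState O q x' y' a) := fun a => by
    have h1 : memoryOp O q x y x' y' (ket a)
        = conj (memState O q x' y' a) • memState O q x y := by
      rw [memoryOp]
      simp only [block_star]
      rw [prod_ofFn_star, ContinuousLinearMap.star_eq_adjoint, ← inner_ket, inner_conj_symm]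
      set A' := (List.ofFn fun k =>
        block (O (q k) : Joint σ ι →L[ℂ] Joint σ ι) (y' k) (x' k)).reverse.prod with hA'
      set A := (List.ofFn fun k =>
        block (O (q k) : Joint σ ι →L[ℂ] Joint σ ι) (y k) (x k)).reverse.prod with hA
      change A (InnerProductSpace.rankOne ℂ (vacuum σ) (vacuum σ)
        (ContinuousLinearMap.adjoint A' (ket a))) = _
      rw [InnerProductSpace.rankOne_apply, map_smul, ContinuousLinearMap.adjoint_inner_right]
      rfl
    rw [h1, inner_smul_right, inner_ket, mul_comm]
  unfold HasTrace
  simp only [h]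
  exact hasSum_memIdx fun l hl M N => by rw [hL l hl, zero_mul]

/-- The one interchange of finite sums behind both the induction on queries and the final trace: the
sums over `M` and `N` separate once `T` and `i` are fixed. -/
theorem sum_mul_conj_rearrange {α α' β γ : Type*} [Fintype α] [Fintype α'] [Fintype β] [Fintype γ]
    (s t : ℂ) (a : β → α → ℂ) (b : β → α' → ℂ) (z : γ → α → ℂ) (w : γ → α' → ℂ) :
    ∑ M, ∑ N, (s * ∑ T, a T M * conj (b T N)) * (t * ∑ i, z i M * conj (w i N)) =
      s * t * ∑ T, ∑ i, (∑ M, z i M * a T M) * conj (∑ N, w i N * b T N) := by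
  calc ∑ M, ∑ N, (s * ∑ T, a T M * conj (b T N)) * (t * ∑ i, z i M * conj (w i N))
      = ∑ M, ∑ N, ∑ T, ∑ i, s * t * ((z i M * a T M) * conj (w i N * b T N)) := by
        refine Finset.sum_congr rfl fun M _ => Finset.sum_congr rfl fun N _ => ?_
        rw [mul_mul_mul_comm, Finset.sum_mul_sum, Finset.mul_sum]
        refine Finset.sum_congr rfl fun T _ => ?_
        rw [Finset.mul_sum]
        refine Finset.sum_congr rfl fun i _ => ?_
        rw [map_mul]
        ring
    _ = ∑ M, ∑ T, ∑ N, ∑ i, s * t * ((z i M * a T M) * conj (w i N * b T N)) :=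
        Finset.sum_congr rfl fun M _ => Finset.sum_comm
    _ = ∑ T, ∑ M, ∑ N, ∑ i, s * t * ((z i M * a T M) * conj (w i N * b T N)) := Finset.sum_comm
    _ = ∑ T, ∑ M, ∑ i, ∑ N, s * t * ((z i M * a T M) * conj (w i N * b T N)) :=
        Finset.sum_congr rfl fun T _ => Finset.sum_congr rfl fun M _ => Finset.sum_comm
    _ = ∑ T, ∑ i, ∑ M, ∑ N, s * t * ((z i M * a T M) * conj (w i N * b T N)) :=
        Finset.sum_congr rfl fun T _ => Finset.sum_comm
    _ = _ := by
        rw [Finset.mul_sum]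
        refine Finset.sum_congr rfl fun T _ => ?_
        rw [Finset.mul_sum]
        refine Finset.sum_congr rfl fun i _ => ?_
        rw [map_sum, Finset.sum_mul_sum, Finset.mul_sum]
        exact Finset.sum_congr rfl fun M _ => (Finset.mul_sum _ _ _).symm

/-- The telescoping of the normalization `d_l^(-1/2)` of the memory state along one query. -/
theorem dualScale_eq (σ : IrrepBasis G) (l l' : UDual G) :
    ((Real.sqrt (σ.d l))⁻¹ : ℂ) * dualScale σ l' l = ((Real.sqrt (σ.d l'))⁻¹ : ℂ) := by
  have h : Real.sqrt (σ.d l) ≠ 0 :=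
    (Real.sqrt_pos.2 (by exact_mod_cast σ.d_pos l)).ne'
  have : (Real.sqrt (σ.d l))⁻¹ * dualScale σ l' l = (Real.sqrt (σ.d l'))⁻¹ := by
    rw [dualScale, Real.sqrt_div (by positivity)]
    field_simp
  exact_mod_cast this

variable {m : UDual G → UDual G → ℕ} {C : CGTensor σ ι m}

omit [Fintype ι] [DecidableEq ι] in
/-- All oracles act by the same tensor on the two registers of the memory. -/
theorem kernel_eq (q : Query) (l l' : UDual G) (M N : Fin (σ.d l)) (M' N' : Fin (σ.d l'))
    (x y : ι) :
    kernel C (dualTensor C) q ⟨l, M, N⟩ x ⟨l', M', N'⟩ y = (dualScale σ l' l : ℂ) *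
      ∑ i, stepTensor C (dualTensor C) q l l' i M' (M, q.col x y) *
        conj (stepTensor C (dualTensor C) q l l' i N' (N, q.row x y)) := by
  have hs := dualScale_mul_dualScale σ l' l
  -- For conjugate and inverse queries the step tensor is the dual one: it occurs once in the kernel
  -- but twice on the right, and reciprocity of the two scales absorbs the surplus.
  have key : ∀ a b : ℂ, (dualScale σ l l' : ℂ) * conj a * b
      = dualScale σ l' l * ((dualScale σ l l' : ℂ) * conj a *
        conj ((dualScale σ l l' : ℂ) * conj b)) := fun a b => by
    rw [map_mul, Complex.conj_conj, Complex.conj_ofReal]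
    linear_combination (-(dualScale σ l l' : ℂ) * conj a * b) * hs
  rw [Finset.mul_sum]
  cases q with
  | forward =>
    refine Finset.sum_congr rfl fun i _ => ?_
    change C l l' i M' (M, x) * (dualScale σ l' l * conj (C l l' i N' (N, y))) =
      dualScale σ l' l * (C l l' i M' (M, x) * conj (C l l' i N' (N, y)))
    ring
  | conjugate => exact Finset.sum_congr rfl fun i _ => key _ _
  | transpose =>
    refine Finset.sum_congr rfl fun i _ => ?_
    change conj (C l l' i N' (N, x)) * conj (dualScale σ l' l * conj (C l l' i M' (M, y))) =
      dualScale σ l' l * (C l l' i M' (M, y) * conj (C l l' i N' (N, x)))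
    rw [map_mul, Complex.conj_conj, Complex.conj_ofReal]
    ring
  | inverse =>
    refine Finset.sum_congr rfl fun i _ => ?_
    change conj (dualScale σ l l' * conj (C l' l i N (N', x))) * conj (C l' l i M (M', y)) =
      dualScale σ l' l * (dualScale σ l l' * conj (C l' l i M (M', y)) *
        conj (dualScale σ l l' * conj (C l' l i N (N', x))))
    rw [← key, map_mul, Complex.conj_conj, Complex.conj_ofReal]
    ring

theorem vacuum_apply (l : UDual G) (M N : Fin (σ.d l)) [Decidable (l = triv G)] :
    vacuum σ ⟨l, M, N⟩ = if l = triv G then 1 else 0 := by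
  classical
  have hsub : Subsingleton (Fin (σ.d (triv G))) := by rw [σ.triv_spec.1]; infer_instance
  rw [vacuum, ket_apply]
  by_cases h : l = triv G
  · subst h
    rw [if_pos rfl, if_pos]
    rw [Subsingleton.elim M ⟨0, σ.d_pos _⟩, Subsingleton.elim N ⟨0, σ.d_pos _⟩]
  · rw [if_neg h, if_neg fun h' => h (congrArg Sigma.fst h')]

variable {R : G →* Matrix.unitaryGroup ι ℂ}

/-- The memory state in terms of the path decomposition. -/
theorem memState_apply (hC : IsCG σ (fun g => (R g : Matrix ι ι ℂ)) m C)
    (hD : IsCG σ (conjRep R) (fun l l' => m l' l) (dualTensor C))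
    {O : Query → unitary (Joint σ ι →L[ℂ] Joint σ ι)}
    (hO : ∀ q, IsOracle C (dualTensor C) q (O q)) :
    ∀ (n : ℕ) (q : Fin n → Query) (x y : Fin n → ι) (l : UDual G) (M N : Fin (σ.d l)),
      memState O q x y ⟨l, M, N⟩ = ((Real.sqrt (σ.d l))⁻¹ : ℂ) * ∑ᶠ T : IrrepPath m n q l,
        pathTensor C (dualTensor C) n q l T M (fun k => (q k).col (x k) (y k)) *
          conj (pathTensor C (dualTensor C) n q l T N fun k => (q k).row (x k) (y k))
  | 0, q, x, y, l, M, N => by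
    classical
    have h1 : memState O q x y = vacuum σ := by simp [memState]
    rw [h1, vacuum_apply]
    by_cases h : l = triv G
    · subst h
      let T₀ : IrrepPath m 0 q (triv G) := ⟨⟨rfl⟩⟩
      have hsub : Subsingleton (IrrepPath m 0 q (triv G)) := by
        unfold IrrepPath
        infer_instance
      have hd : ((Real.sqrt (σ.d (triv G)))⁻¹ : ℂ) = 1 := by
        rw [σ.triv_spec.1]
        simp
      rw [if_pos rfl, finsum_eq_single _ T₀ fun T hT => absurd (Subsingleton.elim T T₀) hT, hd]
      simp [pathTensor]
    · have : IsEmpty (IrrepPath m 0 q l) := ⟨fun T => h T.down.down⟩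
      rw [if_neg h, finsum_of_isEmpty, mul_zero]
  | n + 1, q, x, y, l', M', N' => by
    have hP := isDecomposition_pathTensor hC hD n (Fin.init q)
    obtain ⟨L, hL⟩ := exists_finset_isEmpty hP.finite
    have (l : UDual G) : Finite (IrrepPath m n (Fin.init q) l) := hP.finite_mult l
    have (l : UDual G) : Fintype (IrrepPath m n (Fin.init q) l) := Fintype.ofFinite _
    have ih := memState_apply hC hD hO n (Fin.init q) (Fin.init x) (Fin.init y)
    have hsupp : ∀ l ∉ L, ∀ M N, memState O (Fin.init q) (Fin.init x) (Fin.init y) ⟨l, M, N⟩ = 0 :=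
      fun l hl M N => by
        have := hL l hl
        rw [ih, finsum_of_isEmpty, mul_zero]
    have hL' : ∀ l ∉ L, IsEmpty (IrrepPath m n (Fin.init q) l ×
        Fin (stepMult m (q (Fin.last n)) l l')) := fun l hl => by
      have := hL l hl
      infer_instance
    rw [memState_succ, apply_eq_sum _ hsupp]
    refine Eq.trans ?_ (congrArg _ (finsum_sigma_eq_sum hL' _).symm)
    rw [Finset.mul_sum]
    refine Finset.sum_congr rfl fun l _ => ?_
    simp only [hO (q (Fin.last n)) _ _ _ _, ih, kernel_eq, finsum_eq_sum_of_fintype]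
    -- Splits the new normalization into the old one and the factor of the kernel, so that the sums
    -- over `M` and `N` extend each path by one step.
    rw [Fintype.sum_prod_type, ← dualScale_eq σ l l']
    exact sum_mul_conj_rearrange _ _ _ _ _ _

/-- The trace of the memory operator, through the path decomposition. -/
theorem hasTrace_path (hC : IsCG σ (fun g => (R g : Matrix ι ι ℂ)) m C)
    (hD : IsCG σ (conjRep R) (fun l l' => m l' l) (dualTensor C))
    {O : Query → unitary (Joint σ ι →L[ℂ] Joint σ ι)}
    (hO : ∀ q, IsOracle C (dualTensor C) q (O q)) {n : ℕ} (q : Fin n → Query)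
    (x y x' y' : Fin n → ι) :
    HasTrace (memoryOp O q x y x' y') (∑ᶠ l : UDual G, (σ.d l : ℂ)⁻¹ *
      ∑ᶠ T : IrrepPath m n q l, ∑ᶠ S : IrrepPath m n q l,
        matUnit (pathTensor C (dualTensor C) n q) l T S (fun k => (q k).col (x' k) (y' k))
          (fun k => (q k).col (x k) (y k)) *
        conj (matUnit (pathTensor C (dualTensor C) n q) l T S
          (fun k => (q k).row (x' k) (y' k)) (fun k => (q k).row (x k) (y k)))) := by
  have hP := isDecomposition_pathTensor hC hD n q
  obtain ⟨L, hL⟩ := exists_finset_isEmpty hP.finite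
  have (l : UDual G) : Finite (IrrepPath m n q l) := hP.finite_mult l
  have (l : UDual G) : Fintype (IrrepPath m n q l) := Fintype.ofFinite _
  have hψ := memState_apply hC hD hO n q
  have hsupp : ∀ l ∉ L, ∀ M N, memState O q x y ⟨l, M, N⟩ = 0 := fun l hl M N => by
    have := hL l hl
    rw [hψ, finsum_of_isEmpty, mul_zero]
  have h := hasTrace_memoryOp O q x y x' y' hsupp
  convert h using 1
  rw [finsum_eq_sum_of_forall_notMem (L := L) fun l hl => by
    have := hL l hl
    rw [finsum_of_isEmpty, mul_zero]]
  refine Finset.sum_congr rfl fun l _ => ?_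
  simp only [hψ, finsum_eq_sum_of_fintype, matUnit, Matrix.mul_apply, Matrix.conjTranspose_apply]
  set W := pathTensor C (dualTensor C) n q l
  have hs : ((Real.sqrt (σ.d l))⁻¹ : ℂ) * ((Real.sqrt (σ.d l))⁻¹ : ℂ) = (σ.d l : ℂ)⁻¹ := by
    rw [← mul_inv, ← Complex.ofReal_mul, Real.mul_self_sqrt (by positivity), Complex.ofReal_natCast]
  rw [← hs]
  -- The conjugated state contributes the complex conjugates of its tensors. Its path becomes the
  -- row label of the matrix unit, hence the exchange of sums that follows.
  have key := sum_mul_conj_rearrange ((Real.sqrt (σ.d l))⁻¹ : ℂ) ((Real.sqrt (σ.d l))⁻¹ : ℂ)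
    (fun T M => W T M fun k => (q k).col (x k) (y k))
    (fun T N => W T N fun k => (q k).row (x k) (y k))
    (fun T M => conj (W T M fun k => (q k).col (x' k) (y' k)))
    (fun T N => conj (W T N fun k => (q k).row (x' k) (y' k)))
  rw [Finset.sum_comm]
  refine Eq.trans key.symm ?_
  refine Finset.sum_congr rfl fun M _ => Finset.sum_congr rfl fun N _ => ?_
  congr 1
  rw [map_mul, map_sum, map_inv₀, Complex.conj_ofReal]
  congr 1
  refine Finset.sum_congr rfl fun T _ => ?_
  rw [map_mul]

end Memory

/-! ### Queries as entries of a tensor product representation -/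

section Main

variable {ι : Type v} [Fintype ι] [DecidableEq ι]

theorem Query.op_apply {G : Type u} [Group G] (R : G →* Matrix.unitaryGroup ι ℂ) (q : Query) (g : G) (x y : ι) :
    q.op (R g : Matrix ι ι ℂ) y x = q.base R g (q.row x y) (q.col x y) := by
  cases q <;> rfl

/-- Transposition only exchanges the row and column read, so mixed queries read entries of a single
representation; the adjoint in the second product supplies the complex conjugate. -/
theorem prod_op_eq {G : Type u} [Group G] (R : G →* Matrix.unitaryGroup ι ℂ) {n : ℕ} (q : Fin n → Query) (g : G)
    (x y x' y' : Fin n → ι) :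
    (∏ k, (q k).op (R g : Matrix ι ι ℂ) (y k) (x k)) *
      ∏ k, ((q k).op (R g : Matrix ι ι ℂ))ᴴ (x' k) (y' k) =
    tensorRep R q g (fun k => (q k).row (x k) (y k)) (fun k => (q k).col (x k) (y k)) *
      conj (tensorRep R q g (fun k => (q k).row (x' k) (y' k))
        (fun k => (q k).col (x' k) (y' k))) := by
  simp only [tensorRep, Matrix.of_apply, Matrix.conjTranspose_apply, Query.op_apply, map_prod,
    RCLike.star_def]

end Main

end CompressedOracle

end

open CompressedOracle
theorem theorem1 {G : Type*} [Group G] [TopologicalSpace G] [IsTopologicalGroup G] [CompactSpace G]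
    [MeasurableSpace G] [BorelSpace G] (μ : Measure G) [μ.IsHaarMeasure] [IsProbabilityMeasure μ]
    {ι : Type*} [Fintype ι] [DecidableEq ι] (R : G →* Matrix.unitaryGroup ι ℂ)
    (hR : Continuous fun g => (R g : Matrix ι ι ℂ)) (σ : IrrepBasis G) :
    -- Clebsch–Gordan transforms exist
    (∃ (m : UDual G → UDual G → ℕ) (C : CGTensor σ ι m), IsCG σ (fun g => (R g : Matrix ι ι ℂ)) m C) ∧
    ∀ (m : UDual G → UDual G → ℕ) (C : CGTensor σ ι m),
      IsCG σ (fun g => (R g : Matrix ι ι ℂ)) m C →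
      -- each has a unique dual Clebsch–Gordan transform
      (∃! D : CGTensor σ ι fun l l' => m l' l, IsDualCG σ R C D) ∧
      ∀ D : CGTensor σ ι fun l l' => m l' l, IsDualCG σ R C D →
        -- the two transforms define unitary oracles of all four types
        (∃! O : Query → unitary (Joint σ ι →L[ℂ] Joint σ ι), ∀ q, IsOracle C D q (O q)) ∧
        ∀ (n : ℕ) (q : Fin n → Query),
          -- composing the tensors along paths decomposes the tensor product representation
          IsDecomposition σ (tensorRep R q) (IrrepPath m n q) (pathTensor C D n q) ∧
          IsCommutantMatrixUnits (tensorRep R q) (IrrepPath m n q) (matUnit (pathTensor C D n q)) ∧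
          ∀ O : Query → unitary (Joint σ ι →L[ℂ] Joint σ ι), (∀ q, IsOracle C D q (O q)) →
            -- for the path basis, and for any other orthonormal basis of the multiplicity spaces
            (∀ (B : UDual G → Type*)
              (W : (l : UDual G) → B l → Matrix (Fin (σ.d l)) (Fin n → ι) ℂ),
              IsDecomposition σ (tensorRep R q) B W →
              IsCommutantMatrixUnits (tensorRep R q) B (matUnit W) ∧
              ∀ x y x' y' : Fin n → ι,
                HasTrace (memoryOp O q x y x' y')
                  (∑ᶠ l : UDual G, (σ.d l : ℂ)⁻¹ * ∑ᶠ T : B l, ∑ᶠ S : B l,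
                    matUnit W l T S (fun k => (q k).col (x' k) (y' k))
                      (fun k => (q k).col (x k) (y k)) *
                    conj (matUnit W l T S (fun k => (q k).row (x' k) (y' k))
                      (fun k => (q k).row (x k) (y k)))) ∧
                -- without the conjugation if the matrix units have real entries
                ((∀ l T S a b, (matUnit W l T S a b).im = 0) →
                  HasTrace (memoryOp O q x y x' y')
                    (∑ᶠ l : UDual G, (σ.d l : ℂ)⁻¹ * ∑ᶠ T : B l, ∑ᶠ S : B l,
                      matUnit W l T S (fun k => (q k).col (x' k) (y' k))
                        (fun k => (q k).col (x k) (y k)) *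
                      matUnit W l T S (fun k => (q k).row (x' k) (y' k))
                        (fun k => (q k).row (x k) (y k))))) ∧
            -- the trace is the Haar average
            ∀ x y x' y' : Fin n → ι,
              HasTrace (memoryOp O q x y x' y')
                (∫ g, (∏ k, (q k).op (R g : Matrix ι ι ℂ) (y k) (x k)) *
                  ∏ k, ((q k).op (R g : Matrix ι ι ℂ))ᴴ (x' k) (y' k) ∂μ) := by
  have hρ := IsUnitaryRep.of_hom R hR
  refine ⟨exists_isCG σ hρ, fun m C hC => ⟨⟨dualTensor C, isDualCG_dualTensor hR hC,
    fun D hD => hD.eq_dualTensor hC⟩, fun D hD => ?_⟩⟩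
  -- From here on the dual is the explicit one, with its known normalization.
  obtain rfl := hD.eq_dualTensor hC
  refine ⟨existsUnique_oracle hC hD.isCG, fun n q => ?_⟩
  have hP := isDecomposition_pathTensor hC hD.isCG n q
  refine ⟨hP, hP.isCommutantMatrixUnits, fun O hO => ?_⟩
  -- The path decomposition identifies the trace with the Haar integral, which is then expanded
  -- again in an arbitrary decomposition.
  have htr : ∀ x y x' y' : Fin n → _, HasTrace (memoryOp O q x y x' y')
      (∫ g, tensorRep R q g (fun k => (q k).row (x k) (y k)) (fun k => (q k).col (x k) (y k)) *
        conj (tensorRep R q g (fun k => (q k).row (x' k) (y' k))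
          (fun k => (q k).col (x' k) (y' k))) ∂μ) := fun x y x' y' => by
    rw [hP.integral_eq μ]
    exact hasTrace_path hC hD.isCG hO q x y x' y'
  refine ⟨fun B W hW => ⟨hW.isCommutantMatrixUnits, fun x y x' y' => ?_⟩, fun x y x' y' => ?_⟩
  · have h := htr x y x' y'
    rw [hW.integral_eq μ] at h
    refine ⟨h, fun hreal => ?_⟩
    simpa only [Complex.conj_eq_iff_im.2 (hreal _ _ _ _ _)] using h
  · simp only [prod_op_eq]
    exact htr x y x' y'
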